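/- Let $X,Y,A,B$ be finite sets. Correlations. A family of real numbers $p=\{p(a,b|x,y)\}$ is a non-signalling correlation on $(X,Y,A,B)$ if $p(\cdot,\cdot|x,y)$ is a probability distribution for all $(x,y)\in X\times Y$, the sum $\sum_b p(a,b|x,y)$ does not depend on $y$, and the sum $\sum_a p(a,b|x,y)$ does not depend on $x$. A PVM on a Hilbert space $H$ is a finite family of orthogonal projections with sum $1$. The set $\mathcal C_{\mathrm{qs}}$ (quantum spatial correlations) consists of the $p$ of the form $$p(a,b|x,y)=\langle \xi\,|\,P_{x,a}\otimes Q_{y,b}\,|\,\xi\rangle,\qquad (x,y,a,b)\in X\times Y\times A\times B,$$ where $H$ is a Hilbert space, $\xi\in H\otimes H$ (Hilbert space tensor product) is a unit vector, and $(P_{x,a})_{a\in A}$, $(Q_{y,b})_{b\in B}$ are PVMs on $H$ for all $x\in X$, $y\in Y$. The set $\mathcal C_{\mathrm{q}}$ (quantum correlations) is defined in the same way with $H$ finite-dimensional. The set $\mathcal C_{\mathrm{qm}}$ is the convex hull of the set $\mathcal E$ of those $p$ that have this form with $H$ of finite dimension $d\ge 1$ and $\xi=d^{-1/2}\sum_{i=1}^d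 e_i\otimes e_i$ for an orthonormal basis $(e_i)$ of $H$. Games. A game $\mathcal G=(X,Y,A,B,\lambda)$ is given by a function $\lambda:X\times Y\times A\times B\to\{0,1\}$. Let $\mathcal C(\mathcal G)$ be the set of non-signalling correlations $p$ such that $\lambda(x,y,a,b)=0$ implies $p(a,b|x,y)=0$, and let $\mathcal C_{\mathrm t}(\mathcal G)=\mathcal C_{\mathrm t}\cap\mathcal C(\mathcal G)$ for $\mathrm t\in\{\mathrm{qs},\mathrm q,\mathrm{qm}\}$. The game is an imitation game if for all $x\in X$ and $a\ne a'$ in $A$ there is $y\in Y$ with $\sum_{b}\lambda(x,y,a,b)\lambda(x,y,a',b)=0$, and for all $y\in Y$ and $b\neq b'$ in $B$ there is $x\in X$ with $\sum_a\lambda(x,y,a,b)\lambda(x,y,a,b')=0$. The C*-algebra $C^*(\mathcal G)$ is the universal unital C*-algebra (possibly zero) generated by projections $p_{x,a}$ $(x\in X,a\in A)$ and $q_{y,b}$ $(y\in Y,b\in B)$ subject to $\sum_a p_{x,a}=1$ for all $x$, $\sum_b q_{y,b}=1$ for all $y$, and $p_{x,a}q_{y,b}=0$ whenever $\lambda(x,y,a,b)=0$.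 Theorem. Let $\mathcal G=(X,Y,A,B,\lambda)$ be an imitation game and $p$ a non-signalling correlation on $(X,Y,A,B)$. The following are equivalent: (i) $p\in \mathcal C_{\mathrm{qs}}(\mathcal G)$; (ii) $p\in \mathcal C_{\mathrm{q}}(\mathcal G)$; (iii) $p\in \mathcal C_{\mathrm{qm}}(\mathcal G)$; (iv) $C^*(\mathcal G)\neq\{0\}$, and there exist a finite-dimensional C*-algebra $F$, a tracial state $\tau$ on $F$ and a unital *-homomorphism $\pi:C^*(\mathcal G)\to F$ such that $p(a,b|x,y)=(\tau\circ\pi)(p_{x,a}q_{y,b})$ for all $(x,y,a,b)\in X\times Y\times A\times B$. Moreover, take $Y=X$ and $B=A$, and let $\mathcal C^{\mathrm s}$ be the set of synchronous correlations, that is, $\mathcal C^{\mathrm s}=\mathcal C(\mathcal G^{\mathrm s})$ for the game $\mathcal G^{\mathrm s}$ on $(X,X,A,A)$ with $\lambda(x,y,a,b)=0$ if and only if $x=y$ and $a\ne b$. Then $$\mathcal C_{\mathrm q}\cap\mathcal C^{\mathrm s}=\mathcal C_{\mathrm{qs}}\cap\mathcal C^{\mathrm s}=\mathcal C_{\mathrm{qm}}\cap\mathcal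 C^{\mathrm s}=\operatorname{conv}(\mathcal E\cap\mathcal C^{\mathrm s}).$$ -/

import Mathlib

open UniformSpace
open scoped TensorProduct ComplexOrder

universe u v

/-! ### The free unital *-algebra on self-adjoint generators -/

/-- The unital complex algebra of noncommutative polynomials in the variables `ι`
(linear combinations of words). -/
abbrev FreeStarAlg (ι : Type*) : Type _ := MonoidAlgebra ℂ (FreeMonoid ι)

namespace FreeStarAlg

noncomputable section

variable {ι : Type*}

/-- A word, as an element of the free algebra. -/
def word : FreeMonoid ι →* FreeStarAlg ι := MonoidAlgebra.of ℂ (FreeMonoid ι)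

/-- The variable `i`. -/
def gen (i : ι) : FreeStarAlg ι := word (FreeMonoid.of i)

/-- The extension of an assignment of the variables to a unital algebra homomorphism. -/
def lift {F : Type*} [Ring F] [Algebra ℂ F] (f : ι → F) : FreeStarAlg ι →ₐ[ℂ] F :=
  MonoidAlgebra.lift ℂ F (FreeMonoid ι) (FreeMonoid.lift f)

theorem lift_word {F : Type*} [Ring F] [Algebra ℂ F] (f : ι → F) (w : FreeMonoid ι) :
    lift f (word w) = FreeMonoid.lift f w :=
  MonoidAlgebra.lift_of _ _

@[simp] theorem lift_gen {F : Type*} [Ring F] [Algebra ℂ F] (f : ι → F) (i : ι) :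
    lift f (gen i) = f i := by
  rw [gen, lift_word, FreeMonoid.lift_eval_of]

theorem induction {motive : FreeStarAlg ι → Prop} (x : FreeStarAlg ι)
    (one : motive 1) (gen_mul : ∀ i x, motive x → motive (gen i * x))
    (add : ∀ x y, motive x → motive y → motive (x + y))
    (smul : ∀ (c : ℂ) x, motive x → motive (c • x)) : motive x := by
  refine MonoidAlgebra.induction_on (motive := motive) x (fun w => ?_) add smul
  change motive (word w)
  induction w using FreeMonoid.inductionOn' with
  | one => rw [map_one]; exact one
  | of_mul i w ih => rw [map_mul]; exact gen_mul i _ ih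

/-- Reversal of words together with complex conjugation of the coefficients, as a ring
homomorphism to the opposite algebra. -/
def starHom : FreeStarAlg ι →+* (FreeStarAlg ι)ᵐᵒᵖ :=
  MonoidAlgebra.liftNCRingHom
    ((algebraMap ℂ (FreeStarAlg ι)ᵐᵒᵖ).comp (starRingEnd ℂ))
    (FreeMonoid.lift fun i => MulOpposite.op (gen i))
    (by intro c w; exact Algebra.commute_algebraMap_left (starRingEnd ℂ c) _)

theorem starHom_gen (i : ι) : starHom (gen i) = MulOpposite.op (gen i) := by
  refine (MonoidAlgebra.liftNCRingHom_single _ _ _ _ _).trans ?_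
  rw [map_one, one_mul, FreeMonoid.lift_eval_of]

theorem starHom_algebraMap (c : ℂ) :
    starHom (algebraMap ℂ (FreeStarAlg ι) c) =
      algebraMap ℂ (FreeStarAlg ι)ᵐᵒᵖ (starRingEnd ℂ c) := by
  refine (MonoidAlgebra.liftNCRingHom_single _ _ _ _ _).trans ?_
  simp

theorem starHom_smul (c : ℂ) (x : FreeStarAlg ι) :
    starHom (c • x) = (starRingEnd ℂ c) • starHom x := by
  rw [Algebra.smul_def, map_mul, starHom_algebraMap, Algebra.smul_def]

/-- The involution: it is conjugate linear, reverses products and fixes the variables. -/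
instance : StarRing (FreeStarAlg ι) where
  star x := (starHom x).unop
  star_involutive x := by
    induction x using induction with
    | one => simp
    | gen_mul i x ih => simp [starHom_gen, ih]
    | add x y hx hy => simp [hx, hy]
    | smul c x hx => simp [starHom_smul, hx]
  star_mul x y := by simp
  star_add x y := by simp

theorem star_def (x : FreeStarAlg ι) : star x = (starHom x).unop := rfl

@[simp] theorem star_gen (i : ι) : star (gen i) = gen i := by simp [star_def, starHom_gen]

instance : StarModule ℂ (FreeStarAlg ι) where
  star_smul c x := by simp [star_def, starHom_smul]

theorem lift_star {F : Type*} [Ring F] [StarRing F] [Algebra ℂ F] [StarModule ℂ F]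
    (f : ι → F) (hf : ∀ i, IsSelfAdjoint (f i)) (x : FreeStarAlg ι) :
    lift f (star x) = star (lift f x) := by
  induction x using induction with
  | one => simp
  | gen_mul i x ih => simp [ih, (hf i).star_eq]
  | add x y hx hy => simp [hx, hy]
  | smul c x hx => simp [hx]

end

end FreeStarAlg

/-! ### The universal unital C*-algebra generated by projections subject to relations -/

/-- A C*-seminorm on a unital *-algebra. -/
structure IsCStarSeminorm {𝒜 : Type*} [Ring 𝒜] [StarRing 𝒜] [Algebra ℂ 𝒜]
    (s : Seminorm ℂ 𝒜) : Prop where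
  mul_le : ∀ x y, s (x * y) ≤ s x * s y
  star_mul_self : ∀ x, s (star x * x) = s x ^ 2

/-- The C*-seminorms on the free *-algebra in whose Hausdorff completion the generators are
projections and all `r ∈ R` vanish. -/
def admissibleSeminorms {ι : Type*} (R : Set (FreeStarAlg ι)) : Set (Seminorm ℂ (FreeStarAlg ι)) :=
  {s | IsCStarSeminorm s ∧
    (∀ i, s (FreeStarAlg.gen i * FreeStarAlg.gen i - FreeStarAlg.gen i) = 0) ∧ ∀ r ∈ R, s r = 0}

/-- The largest C*-seminorm satisfying the relations. The supremum exists, see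
`bddAbove_admissibleSeminorms`. -/
noncomputable def universalSeminorm {ι : Type*} (R : Set (FreeStarAlg ι)) :
    Seminorm ℂ (FreeStarAlg ι) :=
  sSup (admissibleSeminorms R)

section UniversalSeminorm

variable {ι : Type*} {R : Set (FreeStarAlg ι)}

theorem zero_mem_admissibleSeminorms : (0 : Seminorm ℂ (FreeStarAlg ι)) ∈ admissibleSeminorms R :=
  ⟨⟨by simp, by simp⟩, by simp, by simp⟩

theorem le_one_of_sq_eq {t : ℝ} (h : t ^ 2 = t) : t ≤ 1 := by nlinarith

theorem map_one_le_of_mem {s : Seminorm ℂ (FreeStarAlg ι)} (hs : s ∈ admissibleSeminorms R) :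
    s 1 ≤ 1 := by
  have h := hs.1.star_mul_self 1
  rw [star_one, one_mul] at h
  exact le_one_of_sq_eq h.symm

theorem map_gen_le_of_mem {s : Seminorm ℂ (FreeStarAlg ι)} (hs : s ∈ admissibleSeminorms R)
    (i : ι) : s (FreeStarAlg.gen i) ≤ 1 := by
  have h := hs.1.star_mul_self (FreeStarAlg.gen i)
  rw [FreeStarAlg.star_gen] at h
  have h1 := hs.2.1 i
  have h2 := abs_sub_map_le_sub s (FreeStarAlg.gen i * FreeStarAlg.gen i) (FreeStarAlg.gen i)
  rw [h1] at h2
  have h3 : s (FreeStarAlg.gen i * FreeStarAlg.gen i) = s (FreeStarAlg.gen i) :=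
    sub_eq_zero.1 (abs_eq_zero.1 (le_antisymm h2 (abs_nonneg _)))
  exact le_one_of_sq_eq (h.symm.trans h3)

theorem exists_bound_admissible (x : FreeStarAlg ι) :
    ∃ M : ℝ, ∀ s ∈ admissibleSeminorms R, s x ≤ M := by
  induction x using FreeStarAlg.induction with
  | one => exact ⟨1, fun s hs => map_one_le_of_mem hs⟩
  | gen_mul i x ih =>
    obtain ⟨M, hM⟩ := ih
    refine ⟨M, fun s hs => (hs.1.mul_le _ _).trans ?_⟩
    calc _ ≤ 1 * s x := by gcongr; exact map_gen_le_of_mem hs i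
      _ ≤ M := by rw [one_mul]; exact hM s hs
  | add x y hx hy =>
    obtain ⟨M, hM⟩ := hx
    obtain ⟨N, hN⟩ := hy
    exact ⟨M + N, fun s hs => (map_add_le_add s x y).trans (add_le_add (hM s hs) (hN s hs))⟩
  | smul c x hx =>
    obtain ⟨M, hM⟩ := hx
    refine ⟨‖c‖ * M, fun s hs => ?_⟩
    rw [map_smul_eq_mul]
    exact mul_le_mul_of_nonneg_left (hM s hs) (norm_nonneg c)

theorem bddAbove_admissibleSeminorms : BddAbove (admissibleSeminorms R) := by
  rw [Seminorm.bddAbove_iff]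
  choose M hM using exists_bound_admissible (R := R)
  refine ⟨M, ?_⟩
  rintro _ ⟨s, hs, rfl⟩ x
  exact hM x s hs

theorem le_universalSeminorm {s : Seminorm ℂ (FreeStarAlg ι)} (hs : s ∈ admissibleSeminorms R)
    (x : FreeStarAlg ι) : s x ≤ universalSeminorm R x :=
  (le_csSup bddAbove_admissibleSeminorms hs : s ≤ universalSeminorm R) x

theorem universalSeminorm_le {x : FreeStarAlg ι} {M : ℝ}
    (h : ∀ s ∈ admissibleSeminorms R, s x ≤ M) : universalSeminorm R x ≤ M := by
  have : Nonempty (admissibleSeminorms R) := ⟨⟨0, zero_mem_admissibleSeminorms⟩⟩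
  rw [universalSeminorm, Seminorm.sSup_apply bddAbove_admissibleSeminorms]
  exact ciSup_le fun s => h s.1 s.2

theorem universalSeminorm_mem : universalSeminorm R ∈ admissibleSeminorms R := by
  have key : ∀ x, (∀ s ∈ admissibleSeminorms R, s x = 0) → universalSeminorm R x = 0 := fun x h =>
    le_antisymm (universalSeminorm_le fun s hs => (h s hs).le) (apply_nonneg _ _)
  refine ⟨⟨fun x y => ?_, fun x => ?_⟩, fun i => key _ fun s hs => hs.2.1 i,
    fun r hr => key _ fun s hs => hs.2.2 r hr⟩
  · refine universalSeminorm_le fun s hs => (hs.1.mul_le x y).trans ?_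
    exact mul_le_mul (le_universalSeminorm hs x) (le_universalSeminorm hs y)
      (apply_nonneg _ _) (apply_nonneg _ _)
  · refine le_antisymm (universalSeminorm_le fun s hs => ?_) ?_
    · rw [hs.1.star_mul_self]
      exact pow_le_pow_left₀ (apply_nonneg _ _) (le_universalSeminorm hs x) 2
    · have h : universalSeminorm R x ≤ √(universalSeminorm R (star x * x)) := by
        refine universalSeminorm_le fun s hs => Real.le_sqrt_of_sq_le ?_
        rw [← hs.1.star_mul_self]
        exact le_universalSeminorm hs _
      calc _ ≤ √(universalSeminorm R (star x * x)) ^ 2 := by gcongr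
        _ = _ := Real.sq_sqrt (apply_nonneg _ _)

end UniversalSeminorm

/-- The free *-algebra, equipped with the largest C*-seminorm satisfying the relations. -/
def PreUniversalCStar {ι : Type*} (_R : Set (FreeStarAlg ι)) : Type _ := FreeStarAlg ι

section PreUniversalCStar

variable {ι : Type*} (R : Set (FreeStarAlg ι))

noncomputable instance : Ring (PreUniversalCStar R) := inferInstanceAs (Ring (FreeStarAlg ι))

noncomputable instance : Algebra ℂ (PreUniversalCStar R) :=
  inferInstanceAs (Algebra ℂ (FreeStarAlg ι))

noncomputable instance : StarRing (PreUniversalCStar R) := inferInstanceAs (StarRing (FreeStarAlg ι))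

instance : StarModule ℂ (PreUniversalCStar R) := inferInstanceAs (StarModule ℂ (FreeStarAlg ι))

/-- The norm of `x` is `universalSeminorm R x`. -/
noncomputable instance : SeminormedRing (PreUniversalCStar R) :=
  RingSeminorm.toSeminormedRing
    { toFun := fun x => universalSeminorm R x
      map_zero' := map_zero (universalSeminorm R)
      add_le' := map_add_le_add (universalSeminorm R)
      neg' := map_neg_eq_map (universalSeminorm R)
      mul_le' := universalSeminorm_mem.1.mul_le }

theorem PreUniversalCStar.norm_def (x : PreUniversalCStar R) : ‖x‖ = universalSeminorm R x := rfl

noncomputable instance : NormedAlgebra ℂ (PreUniversalCStar R) where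
  norm_smul_le c x := (map_smul_eq_mul (universalSeminorm R) c x).le

theorem PreUniversalCStar.norm_star_mul_self (x : PreUniversalCStar R) :
    ‖star x * x‖ = ‖x‖ ^ 2 :=
  universalSeminorm_mem.1.star_mul_self x

instance : NormedStarGroup (PreUniversalCStar R) where
  norm_star_le x := by
    have h : ∀ y : PreUniversalCStar R, ‖y‖ ≤ ‖star y‖ := fun y => by
      have h1 : ‖y‖ ^ 2 ≤ ‖star y‖ * ‖y‖ :=
        (PreUniversalCStar.norm_star_mul_self R y) ▸ norm_mul_le (star y) y
      by_contra! hlt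
      nlinarith [norm_nonneg (star y), norm_nonneg y]
    simpa using h (star x)

end PreUniversalCStar

/-- The universal unital C*-algebra generated by projections `ι` subject to the relations `r = 0`,
`r ∈ R`: the Hausdorff completion of the free *-algebra in the largest C*-seminorm satisfying the
relations. It is the zero algebra if that seminorm is zero. -/
def UniversalCStar {ι : Type*} (R : Set (FreeStarAlg ι)) : Type _ := Completion (PreUniversalCStar R)

namespace UniversalCStar

noncomputable section

variable {ι : Type*} (R : Set (FreeStarAlg ι))

instance : NormedRing (UniversalCStar R) :=
  inferInstanceAs (NormedRing (Completion (PreUniversalCStar R)))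

instance : CompleteSpace (UniversalCStar R) :=
  inferInstanceAs (CompleteSpace (Completion (PreUniversalCStar R)))

instance : Algebra ℂ (UniversalCStar R) :=
  inferInstanceAs (Algebra ℂ (Completion (PreUniversalCStar R)))

/-- The canonical map from the free *-algebra. -/
def of : PreUniversalCStar R →ₐ[ℂ] UniversalCStar R where
  toRingHom := (Completion.coeRingHom : PreUniversalCStar R →+* Completion (PreUniversalCStar R))
  commutes' _ := rfl

theorem norm_of (x : PreUniversalCStar R) : ‖of R x‖ = ‖x‖ :=
  Completion.norm_coe x

theorem denseRange_of : DenseRange (of R) := Completion.denseRange_coe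

@[elab_as_elim]
theorem induction_on {motive : UniversalCStar R → Prop} (x : UniversalCStar R)
    (closed : IsClosed {x | motive x}) (of : ∀ x, motive (of R x)) : motive x :=
  Completion.induction_on x closed of

instance : NormedAlgebra ℂ (UniversalCStar R) where
  norm_smul_le c x := by
    rw [Algebra.smul_def]
    induction x using induction_on with
    | closed => exact isClosed_le (by fun_prop) (by fun_prop)
    | of x =>
      rw [← (of R).commutes, ← map_mul, norm_of, norm_of, ← Algebra.smul_def]
      exact norm_smul_le c x

/-- The continuous extension of the involution of the free *-algebra. -/
instance : Star (UniversalCStar R) where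
  star := Completion.map (star : PreUniversalCStar R → PreUniversalCStar R)

theorem continuous_star' : Continuous (star : UniversalCStar R → UniversalCStar R) :=
  Completion.continuous_map

theorem star_of (x : PreUniversalCStar R) : star (of R x) = of R (star x) :=
  Completion.map_coe star_isometry.uniformContinuous x

instance : StarRing (UniversalCStar R) where
  star_involutive x := by
    have := continuous_star' R
    induction x using induction_on with
    | closed => exact isClosed_eq (by fun_prop) (by fun_prop)
    | of x => simp [star_of]
  star_mul x y := by
    have := continuous_star' R
    induction x using induction_on with
    | closed => exact isClosed_eq (by fun_prop) (by fun_prop)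
    | of x =>
      induction y using induction_on with
      | closed => exact isClosed_eq (by fun_prop) (by fun_prop)
      | of y => rw [← map_mul, star_of, star_of, star_of, star_mul, map_mul]
  star_add x y := by
    have := continuous_star' R
    induction x using induction_on with
    | closed => exact isClosed_eq (by fun_prop) (by fun_prop)
    | of x =>
      induction y using induction_on with
      | closed => exact isClosed_eq (by fun_prop) (by fun_prop)
      | of y => rw [← map_add, star_of, star_of, star_of, star_add, map_add]

theorem star_algebraMap (c : ℂ) :
    star (algebraMap ℂ (UniversalCStar R) c) = algebraMap ℂ (UniversalCStar R) (star c) := by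
  rw [← (of R).commutes, ← (of R).commutes, star_of, algebraMap_star_comm]

instance : StarModule ℂ (UniversalCStar R) where
  star_smul c x := by
    rw [Algebra.smul_def, star_mul, star_algebraMap, Algebra.smul_def, Algebra.commutes]

instance : CStarRing (UniversalCStar R) where
  norm_mul_self_le x := by
    have := continuous_star' R
    induction x using induction_on with
    | closed => exact isClosed_le (by fun_prop) (by fun_prop)
    | of x =>
      rw [star_of, ← map_mul, norm_of, norm_of, PreUniversalCStar.norm_star_mul_self, sq]

instance : CStarAlgebra (UniversalCStar R) where

/-- The generating projection `i`. -/
def gen (i : ι) : UniversalCStar R := of R (FreeStarAlg.gen i)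

theorem of_eq_zero {x : FreeStarAlg ι} (hx : universalSeminorm R x = 0) : of R x = 0 :=
  norm_eq_zero.1 ((norm_of R x).trans hx)

theorem isStarProjection_gen (i : ι) : IsStarProjection (gen R i) where
  isIdempotentElem := by
    let g : PreUniversalCStar R := FreeStarAlg.gen i
    have h : of R (g * g - g) = 0 := of_eq_zero R (universalSeminorm_mem.2.1 i)
    rw [map_sub, map_mul, sub_eq_zero] at h
    exact h
  isSelfAdjoint := (star_of R _).trans (congrArg (of R) (FreeStarAlg.star_gen i))

theorem lift_gen (x : FreeStarAlg ι) : FreeStarAlg.lift (gen R) x = of R x := by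
  induction x using FreeStarAlg.induction with
  | one => exact (map_one (FreeStarAlg.lift (gen R))).trans (map_one (of R)).symm
  | gen_mul i x ih =>
    rw [map_mul, ih, FreeStarAlg.lift_gen]
    exact (map_mul (of R) _ _).symm
  | add x y hx hy =>
    rw [map_add, hx, hy]
    exact (map_add (of R) _ _).symm
  | smul c x hx =>
    rw [map_smul, hx]
    exact (map_smul (of R) _ _).symm

/-- Every relation holds in the universal algebra. -/
theorem lift_gen_relation {r : FreeStarAlg ι} (hr : r ∈ R) : FreeStarAlg.lift (gen R) r = 0 :=
  (lift_gen R r).trans (of_eq_zero R (universalSeminorm_mem.2.2 r hr))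

/-- The universal property. -/
theorem existsUnique_lift {F : Type*} [CStarAlgebra F] (f : ι → F)
    (hf : ∀ i, IsStarProjection (f i)) (hR : ∀ r ∈ R, FreeStarAlg.lift f r = 0) :
    ∃! π : UniversalCStar R →⋆ₐ[ℂ] F, ∀ i, π (gen R i) = f i := by
  have hstar := FreeStarAlg.lift_star f fun i => (hf i).isSelfAdjoint
  have hs : (normSeminorm ℂ F).comp (FreeStarAlg.lift f).toLinearMap ∈ admissibleSeminorms R := by
    refine ⟨⟨fun x y => ?_, fun x => ?_⟩, fun i => ?_, fun r hr => ?_⟩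
    · simpa using norm_mul_le (FreeStarAlg.lift f x) (FreeStarAlg.lift f y)
    · simp [hstar, CStarRing.norm_star_mul_self, sq]
    · simp [(hf i).isIdempotentElem.eq]
    · simp [hR r hr]
  let φ : PreUniversalCStar R →ₐ[ℂ] F := FreeStarAlg.lift f
  have hφ : ∀ x, ‖φ x‖ ≤ ‖x‖ := fun x => le_universalSeminorm hs x
  have hcont : Continuous φ :=
    AddMonoidHomClass.continuous_of_bound φ 1 fun x => by simpa using hφ x
  let ψ : UniversalCStar R →+* F := Completion.extensionHom φ.toRingHom hcont
  have hψ : ∀ x, ψ (of R x) = φ x := Completion.extensionHom_coe φ.toRingHom hcont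
  have hψc : Continuous ψ := Completion.continuous_extension
  have hsc := continuous_star' R
  let π : UniversalCStar R →⋆ₐ[ℂ] F :=
    { ψ with
      commutes' := fun c => by
        change ψ (algebraMap ℂ _ c) = _
        rw [← (of R).commutes, hψ, φ.commutes]
      map_star' := fun x => by
        change ψ (star x) = star (ψ x)
        induction x using induction_on with
        | closed => exact isClosed_eq (by fun_prop) (by fun_prop)
        | of x => rw [star_of, hψ, hψ]; exact hstar x }
  refine ⟨π, fun i => (hψ _).trans (FreeStarAlg.lift_gen f i), fun ρ hρ => ?_⟩
  have hρ' : ∀ x : FreeStarAlg ι, ρ (of R x) = φ x := fun x => by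
    induction x using FreeStarAlg.induction with
    | one => exact ((congrArg ρ (map_one (of R))).trans (map_one ρ)).trans (map_one φ).symm
    | gen_mul i x ih =>
      have h1 : of R (FreeStarAlg.gen i * x) = gen R i * of R x := map_mul (of R) _ _
      have h2 : φ (FreeStarAlg.gen i * x) = f i * φ x :=
        (map_mul φ _ _).trans (congrArg (· * φ x) (FreeStarAlg.lift_gen f i))
      rw [h1, h2, map_mul, hρ, ih]
    | add x y hx hy =>
      have h1 : of R (x + y) = of R x + of R y := map_add (of R) _ _
      have h2 : φ (x + y) = φ x + φ y := map_add φ _ _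
      rw [h1, h2, map_add, hx, hy]
    | smul c x hx =>
      have h1 : of R (c • x) = c • of R x := map_smul (of R) _ _
      have h2 : φ (c • x) = c • φ x := map_smul φ _ _
      rw [h1, h2, map_smul, hx]
  have hρc : Continuous ρ :=
    AddMonoidHomClass.continuous_of_bound ρ 1 fun x => by
      simpa using NonUnitalStarAlgHom.norm_apply_le ρ x
  ext x
  change ρ x = ψ x
  induction x using induction_on with
  | closed => exact isClosed_eq hρc hψc
  | of x => rw [hψ]; exact hρ' x

end

end UniversalCStar

/-! ### Games and correlations -/

/-- A two-player game with question sets `X`, `Y`, answer sets `A`, `B` and rule function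
`λ : X × Y × A × B → {0, 1}`; the answers `a`, `b` to `x`, `y` are acceptable if `λ` is `1`. -/
structure Game (X Y A B : Type*) where
  rule : X → Y → A → B → Fin 2

/-- A family of real numbers `p x y a b`, written `p(a, b | x, y)`. -/
abbrev Correlation (X Y A B : Type*) := X → Y → A → B → ℝ

/-- Projection-valued measures: finite families of (self-adjoint) projections with sum one. -/
def IsPVM {ι M : Type*} [Fintype ι] [Semiring M] [Star M] (P : ι → M) : Prop :=
  (∀ i, IsStarProjection (P i)) ∧ ∑ i, P i = 1

section Games

variable {X Y A B : Type*} [Fintype A] [Fintype B]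

/-- Non-signalling correlations. -/
structure IsNonSignalling (p : Correlation X Y A B) : Prop where
  marginal_left : ∀ x y y' a, ∑ b, p x y a b = ∑ b, p x y' a b
  marginal_right : ∀ x x' y b, ∑ a, p x y a b = ∑ a, p x' y a b
  nonneg : ∀ x y a b, 0 ≤ p x y a b
  sum_eq_one : ∀ x y, ∑ a, ∑ b, p x y a b = 1

/-- The perfect strategies of a game: the non-signalling correlations supported on acceptable
answers. -/
def Game.perfectStrategies (G : Game X Y A B) : Set (Correlation X Y A B) :=
  {p | IsNonSignalling p ∧ ∀ x y a b, G.rule x y a b = 0 → p x y a b = 0}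

/-- Imitation games. -/
structure Game.IsImitation (G : Game X Y A B) : Prop where
  left : ∀ x a a', a ≠ a' → ∃ y, ∑ b, (G.rule x y a b : ℕ) * (G.rule x y a' b : ℕ) = 0
  right : ∀ y b b', b ≠ b' → ∃ x, ∑ a, (G.rule x y a b : ℕ) * (G.rule x y a b' : ℕ) = 0

open Classical in
/-- The synchronicity game: equal questions require equal answers. -/
noncomputable def syncGame (X A : Type*) : Game X X A A where
  rule x y a b := if x = y ∧ a ≠ b then 0 else 1

/-- The relations `∑ₐ p_{x,a} = 1`, `∑_b q_{y,b} = 1`, and `p_{x,a} q_{y,b} = 0` if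
`λ(x, y, a, b) = 0`, in the free *-algebra on the symbols `p_{x,a}` and `q_{y,b}`. -/
def Game.relations (G : Game X Y A B) : Set (FreeStarAlg ((X × A) ⊕ (Y × B))) :=
  {r | (∃ x, r = ∑ a, FreeStarAlg.gen (Sum.inl (x, a)) - 1) ∨
    (∃ y, r = ∑ b, FreeStarAlg.gen (Sum.inr (y, b)) - 1) ∨
    ∃ x y a b, G.rule x y a b = 0 ∧
      r = FreeStarAlg.gen (Sum.inl (x, a)) * FreeStarAlg.gen (Sum.inr (y, b))}

/-- The C*-algebra `C*(G)` of a game. -/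
abbrev Game.CStar (G : Game X Y A B) : Type _ := UniversalCStar G.relations

/-- The generator `p_{x,a}` of `C*(G)`. -/
noncomputable def Game.projA (G : Game X Y A B) (x : X) (a : A) : G.CStar :=
  UniversalCStar.gen G.relations (Sum.inl (x, a))

/-- The generator `q_{y,b}` of `C*(G)`. -/
noncomputable def Game.projB (G : Game X Y A B) (y : Y) (b : B) : G.CStar :=
  UniversalCStar.gen G.relations (Sum.inr (y, b))

end Games

/-- Tracial states on a unital C*-algebra. -/
structure IsTracialState {F : Type*} [CStarAlgebra F] (τ : F →ₗ[ℂ] ℂ) : Prop where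
  nonneg : ∀ z, 0 ≤ τ (star z * z)
  map_one : τ 1 = 1
  tracial : ∀ z w, τ (z * w) = τ (w * z)

/-! ### Quantum correlations -/

section Quantum

/-- The Hilbert space tensor product: the completion of the algebraic tensor product. -/
abbrev HilbertTensor (H K : Type*) [NormedAddCommGroup H] [InnerProductSpace ℂ H]
    [NormedAddCommGroup K] [InnerProductSpace ℂ K] : Type _ :=
  Completion (H ⊗[ℂ] K)

/-- The operator `S ⊗ T` on the Hilbert space tensor product. -/
noncomputable def tensorOp {H K : Type*} [NormedAddCommGroup H] [InnerProductSpace ℂ H]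
    [NormedAddCommGroup K] [InnerProductSpace ℂ K] (S : H →L[ℂ] H) (T : K →L[ℂ] K) :
    HilbertTensor H K →L[ℂ] HilbertTensor H K :=
  (TensorProduct.mapL S T).completion

theorem tensorOp_tmul {H K : Type*} [NormedAddCommGroup H] [InnerProductSpace ℂ H]
    [NormedAddCommGroup K] [InnerProductSpace ℂ K] (S : H →L[ℂ] H) (T : K →L[ℂ] K) (v : H)
    (w : K) : tensorOp S T ((v ⊗ₜ[ℂ] w : H ⊗[ℂ] K) : HilbertTensor H K) =
      ((S v ⊗ₜ[ℂ] T w : H ⊗[ℂ] K) : HilbertTensor H K) :=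
  Completion.map_coe (TensorProduct.mapL S T).uniformContinuous _

/-- The maximally entangled vector `d^{-1/2} ∑ᵢ eᵢ ⊗ eᵢ`. -/
noncomputable def maxEntangled {H : Type*} [NormedAddCommGroup H] [InnerProductSpace ℂ H] {d : ℕ}
    (e : OrthonormalBasis (Fin d) ℂ H) : HilbertTensor H H :=
  (((((√(d : ℝ))⁻¹ : ℝ) : ℂ) • ∑ i, e i ⊗ₜ[ℂ] e i : H ⊗[ℂ] H) : HilbertTensor H H)

variable {X Y A B : Type*} [Fintype A] [Fintype B]

/-- `p(a, b | x, y) = ⟨ξ| P_{x,a} ⊗ Q_{y,b} |ξ⟩` for some PVMs `(P_{x,a})ₐ` and `(Q_{y,b})_b`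
on the Hilbert space `H`. -/
def IsRealizedBy {H : Type*} [NormedAddCommGroup H] [InnerProductSpace ℂ H] [CompleteSpace H]
    (p : Correlation X Y A B) (ξ : HilbertTensor H H) : Prop :=
  ∃ (P : X → A → H →L[ℂ] H) (Q : Y → B → H →L[ℂ] H),
    (∀ x, IsPVM (P x)) ∧ (∀ y, IsPVM (Q y)) ∧
      ∀ x y a b, (p x y a b : ℂ) = inner ℂ ξ (tensorOp (P x a) (Q y b) ξ)

variable (X Y A B)

/-- Quantum spatial correlations. -/
def quantumSpatial : Set (Correlation X Y A B) :=
  {p | ∃ (H : Type u) (_ : NormedAddCommGroup H) (_ : InnerProductSpace ℂ H) (_ : CompleteSpace H)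
    (ξ : HilbertTensor H H), ‖ξ‖ = 1 ∧ IsRealizedBy p ξ}

/-- Quantum correlations. -/
def quantum : Set (Correlation X Y A B) :=
  {p | ∃ (H : Type u) (_ : NormedAddCommGroup H) (_ : InnerProductSpace ℂ H) (_ : CompleteSpace H)
    (_ : FiniteDimensional ℂ H) (ξ : HilbertTensor H H), ‖ξ‖ = 1 ∧ IsRealizedBy p ξ}

/-- Quantum correlations realized by a maximally entangled vector. -/
def maxEntangledCorrelations : Set (Correlation X Y A B) :=
  {p | ∃ (H : Type u) (_ : NormedAddCommGroup H) (_ : InnerProductSpace ℂ H) (_ : CompleteSpace H)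
    (d : ℕ) (e : OrthonormalBasis (Fin d) ℂ H), 0 < d ∧ IsRealizedBy p (maxEntangled e)}

/-- Maximally entangled quantum correlations: the convex hull of the correlations realized by a
maximally entangled vector. -/
def quantumMaxEntangled : Set (Correlation X Y A B) :=
  convexHull ℝ (maxEntangledCorrelations.{u} X Y A B)

end Quantum

/-!
A state `ξ ∈ H ⊗ K` is handled through the conjugate-linear operators `S : H → K` and `T : K → H`
that it induces (`HilbertTensor.slice`, `HilbertTensor.sliceRight`); they satisfy
`⟨v, S u⟩ = ⟨u ⊗ v, ξ⟩ = ⟨u, T v⟩`, and `R = T S` is the reduced density operator of `ξ`, a compact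
positive operator. If `ξ` realizes a perfect strategy with PVMs `P_x`, `Q_y`, then
`λ(x, y, a, b) = 0` forces `(P_{x,a} ⊗ Q_{y,b}) ξ = 0`, that is, `P_{x,a} T Q_{y,b} = 0` and
`Q_{y,b} S P_{x,a} = 0`. Inserting `∑_b Q_{y,b}² = 1` between `T` and `S`, the imitation property
gives `P_{x,a} T S P_{x,a'} = 0` for `a ≠ a'`, so that every `P_{x,a}` commutes with `T S`, and in
the same way every `Q_{y,b}` commutes with `S T`. Hence on each eigenspace of `R` for an eigenvalue
`μ ≠ 0`, which is finite-dimensional, both the `P_{x,a}` and the operators `μ⁻¹ T Q_{y,b} S`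
restrict to PVMs. Expanding `⟨ξ, (P_{x,a} ⊗ Q_{y,b}) ξ⟩` along an orthonormal basis of eigenvectors
(`HilbertTensor.hasSum_inner_slice`) exhibits the correlation as an infinite convex combination of
correlations `tr(P Q)` of matrices under the normalized trace (`IsTraceRealized`). In finite
dimension a convex set is closed under infinite convex combinations (`mem_convexHull_of_hasSum`),
so a finite convex combination suffices: `Game.mem_convexHull_of_isRealizedBy`.

The trace correlations are exactly those of maximally entangled states, by transposition of the
second PVM (`mem_maxEntangledCorrelations_iff`). A perfect finite convex combination of them is a
convex combination of perfect ones, because the perfect strategies form a face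
(`Game.convexHull_inter_perfectStrategies`), and it is induced by a tracial state on a direct sum
of matrix algebras (`Game.exists_tracialState`).

Conversely, a tracial state `τ` on a finite-dimensional C*-algebra `F` factors through its GNS
representation `L`. The trace form is nondegenerate on the image of `L`, whence `τ = tr(D L(·))` for
some `D` in that image; traciality makes `D` central, positivity of `τ` makes it positive, and with
`C = √D` one has `τ(p q) = tr(C L(p) C L(q))` (`IsTracialState.exists_trace`). This is the
correlation of the state `∑ᵢ C eᵢ ⊗ eᵢ`, so that it is a quantum correlation
(`Game.mem_quantum_of_tracialState`).

The synchronicity game is an imitation game, so the statement on synchronous correlations is a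
special case.
-/

/-! ### Infinite convex combinations in finite dimension -/

/-- In finite dimension, the sum of a convergent series with positive coefficients is a finite
combination, with nonnegative coefficients, of its terms: finitely many of the vectors span all of
them, and a late enough remainder has small coordinates with respect to these, so that it can be
absorbed in their coefficients. -/
theorem exists_nonneg_sum_eq_of_hasSum {V ι : Type*} [NormedAddCommGroup V] [NormedSpace ℝ V]
    [FiniteDimensional ℝ V] {c : ι → ℝ} (hc : ∀ i, 0 < c i) {z : ι → V} {p : V}
    (h : HasSum (fun i => c i • z i) p) :
    ∃ (t : Finset ι) (w : ι → ℝ), (∀ i, 0 ≤ w i) ∧ ∑ i ∈ t, w i • z i = p := by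
  classical
  obtain ⟨κ, a, ha, hspan, hli⟩ := exists_linearIndependent' ℝ z
  have : Finite κ := hli.finite
  have := Fintype.ofFinite κ
  set W : Submodule ℝ V := Submodule.span ℝ (Set.range (z ∘ a)) with hW
  have hzW : ∀ i, z i ∈ W := fun i => hspan ▸ Submodule.subset_span ⟨i, rfl⟩
  have hsW : ∀ t : Finset ι, ∑ i ∈ t, c i • z i ∈ W := fun t =>
    W.sum_mem fun i _ => W.smul_mem _ (hzW i)
  have hpW : p ∈ W :=
    W.closed_of_finiteDimensional.mem_of_tendsto h (Filter.Eventually.of_forall hsW)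
  let b : Module.Basis κ ℝ W := Module.Basis.span hli
  let r : Finset ι → W := fun t => ⟨p - ∑ i ∈ t, c i • z i, W.sub_mem hpW (hsW t)⟩
  have hr : Filter.Tendsto r Filter.atTop (nhds 0) := by
    rw [tendsto_subtype_rng]
    have h0 : Filter.Tendsto (fun t : Finset ι => p - ∑ i ∈ t, c i • z i) Filter.atTop
        (nhds (p - p)) := tendsto_const_nhds.sub h
    simpa using h0
  have hcoord : ∀ k, ∀ᶠ t in Filter.atTop, -c (a k) < b.coord k (r t) := fun k => by
    have h1 := ((LinearMap.continuous_of_finiteDimensional (b.coord k)).tendsto 0).comp hr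
    rw [map_zero] at h1
    exact h1.eventually_const_lt (by linarith [hc (a k)])
  obtain ⟨t, ht, hat⟩ := ((Filter.eventually_all.2 hcoord).and
    (Filter.eventually_ge_atTop (Finset.univ.image a))).exists
  let g : ι → ℝ := fun i => ∑ k, if a k = i then b.coord k (r t) else 0
  have hga : ∀ k, g (a k) = b.coord k (r t) := fun k => by
    simp [g, ha.eq_iff]
  have hg0 : ∀ i, i ∉ Set.range a → g i = 0 := fun i hi =>
    Finset.sum_eq_zero fun k _ => if_neg fun h => hi ⟨k, h⟩
  refine ⟨t, fun i => c i + g i, fun i => ?_, ?_⟩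
  · change 0 ≤ c i + g i
    by_cases hi : i ∈ Set.range a
    · obtain ⟨k, rfl⟩ := hi
      rw [hga]
      linarith [ht k]
    · rw [hg0 i hi, add_zero]
      exact (hc i).le
  · have h2 : ∑ i ∈ t, g i • z i = ∑ k, b.coord k (r t) • z (a k) := by
      rw [← Finset.sum_subset hat, Finset.sum_image fun _ _ _ _ h => ha h]
      · simp_rw [hga]
      · intro i _ hi
        rw [hg0 i (by simpa using hi), zero_smul]
    have h3 : ∑ k, b.coord k (r t) • z (a k) = p - ∑ i ∈ t, c i • z i := by
      have h4 : ∀ k, (b k : V) = z (a k) := fun k =>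
        congrArg Subtype.val (Module.Basis.span_apply hli k)
      have h5 := congrArg W.subtype (b.sum_repr (r t))
      rw [map_sum] at h5
      simp only [map_smul, Submodule.subtype_apply, h4] at h5
      exact h5
    simp_rw [add_smul, Finset.sum_add_distrib, h2, h3, add_sub_cancel]

/-- A convex set in finite dimension contains every infinite convex combination of its points,
whether or not it is closed. -/
theorem mem_convexHull_of_hasSum {V ι : Type*} [NormedAddCommGroup V] [NormedSpace ℝ V]
    [FiniteDimensional ℝ V] {s : Set V} {c : ι → ℝ} (hc : ∀ i, 0 < c i) {z : ι → V} {p : V}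
    (hz : ∀ i, z i ∈ s) (h1 : HasSum c 1) (h : HasSum (fun i => c i • z i) p) :
    p ∈ convexHull ℝ s := by
  -- Adjoining the coordinate `1` to each vector keeps track of the sum of the coefficients.
  have h' : HasSum (fun i => c i • (z i, (1 : ℝ))) (p, 1) := by
    simpa using h.prodMk h1
  obtain ⟨t, w, hw, ht⟩ := exists_nonneg_sum_eq_of_hasSum hc h'
  have e1 : ∑ i ∈ t, w i • z i = p := by simpa [Prod.fst_sum] using congrArg Prod.fst ht
  have e2 : ∑ i ∈ t, w i = 1 := by simpa [Prod.snd_sum] using congrArg Prod.snd ht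
  rw [← e1]
  exact (convex_convexHull ℝ s).sum_mem (fun i _ => hw i) e2
    fun i _ => subset_convexHull ℝ s (hz i)

/-! ### Correlations of matrices under the normalized trace -/

/-- Correlations `p(a, b | x, y) = tr(P_{x,a} Q_{y,b})` for PVMs of complex matrices of some size
`d ≥ 1`, where `tr` is the normalized trace. -/
def IsTraceRealized {X Y A B : Type*} [Fintype A] [Fintype B] (p : Correlation X Y A B) : Prop :=
  ∃ (d : ℕ) (P : X → A → Matrix (Fin d) (Fin d) ℂ) (Q : Y → B → Matrix (Fin d) (Fin d) ℂ),
    0 < d ∧ (∀ x, IsPVM (P x)) ∧ (∀ y, IsPVM (Q y)) ∧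
      ∀ x y a b, (p x y a b : ℂ) = (d : ℂ)⁻¹ * (P x a * Q y b).trace

theorem IsPVM.map {ι M N F : Type*} [Fintype ι] [Semiring M] [Star M] [Semiring N] [Star N]
    [FunLike F M N] [RingHomClass F M N] [StarHomClass F M N] {P : ι → M} (hP : IsPVM P) (φ : F) :
    IsPVM fun i => φ (P i) := by
  refine ⟨fun i => ⟨?_, ?_⟩, ?_⟩
  · rw [IsIdempotentElem, ← map_mul, (hP.1 i).isIdempotentElem.eq]
  · rw [IsSelfAdjoint, ← map_star, (hP.1 i).isSelfAdjoint.star_eq]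
  · rw [← map_sum, hP.2, map_one]

theorem IsPVM.transpose {ι n : Type*} [Fintype ι] [Fintype n] [DecidableEq n]
    {P : ι → Matrix n n ℂ} (hP : IsPVM P) : IsPVM fun i => (P i).transpose := by
  refine ⟨fun i => ⟨?_, ?_⟩, ?_⟩
  · rw [IsIdempotentElem, ← Matrix.transpose_mul, (hP.1 i).isIdempotentElem.eq]
  · have h := (hP.1 i).isSelfAdjoint.star_eq
    rw [Matrix.star_eq_conjTranspose] at h
    exact congrArg Matrix.transpose h
  · rw [← Matrix.transpose_sum, hP.2, Matrix.transpose_one]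

section Trace

variable {n : Type*} [Fintype n]

/-- The trace of a product of projections is that of a positive matrix. -/
theorem IsStarProjection.trace_mul_eq {P Q : Matrix n n ℂ} (hP : IsStarProjection P)
    (hQ : IsStarProjection Q) :
    (P * Q).trace = (star (P * Q) * (P * Q)).trace := by
  rw [star_mul, hP.isSelfAdjoint.star_eq, hQ.isSelfAdjoint.star_eq, mul_assoc, ← mul_assoc P,
    hP.isIdempotentElem.eq, Matrix.trace_mul_comm Q, mul_assoc, hQ.isIdempotentElem.eq]

theorem trace_star_mul_self_nonneg (M : Matrix n n ℂ) : 0 ≤ (star M * M).trace :=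
  (Matrix.posSemidef_conjTranspose_mul_self M).trace_nonneg

theorem IsStarProjection.normalized_trace_mul_nonneg {P Q : Matrix n n ℂ} (hP : IsStarProjection P)
    (hQ : IsStarProjection Q) (d : ℕ) : 0 ≤ (d : ℂ)⁻¹ * (P * Q).trace := by
  rw [hP.trace_mul_eq hQ, ← Complex.ofReal_natCast, ← Complex.ofReal_inv]
  exact mul_nonneg (Complex.zero_le_real.2 (by positivity)) (trace_star_mul_self_nonneg _)

end Trace

section

variable {X Y A B : Type*} [Fintype A] [Fintype B] {p : Correlation X Y A B}

theorem IsTraceRealized.isNonSignalling (hp : IsTraceRealized p) : IsNonSignalling p := by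
  obtain ⟨d, P, Q, hd, hP, hQ, h⟩ := hp
  have hsumB : ∀ x y a, ((∑ b, p x y a b : ℝ) : ℂ) = (d : ℂ)⁻¹ * (P x a).trace := fun x y a => by
    rw [Complex.ofReal_sum]
    simp_rw [h, ← Finset.mul_sum, ← Matrix.trace_sum, ← Finset.mul_sum, (hQ y).2, mul_one]
  have hsumA : ∀ x y b, ((∑ a, p x y a b : ℝ) : ℂ) = (d : ℂ)⁻¹ * (Q y b).trace := fun x y b => by
    rw [Complex.ofReal_sum]
    simp_rw [h, ← Finset.mul_sum, ← Matrix.trace_sum, ← Finset.sum_mul, (hP x).2, one_mul]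
  refine ⟨fun x y y' a => ?_, fun x x' y b => ?_, fun x y a b => ?_, fun x y => ?_⟩
  · exact_mod_cast (hsumB x y a).trans (hsumB x y' a).symm
  · exact_mod_cast (hsumA x y b).trans (hsumA x' y b).symm
  · have h0 : (0 : ℂ) ≤ (p x y a b : ℂ) := by
      rw [h]
      exact ((hP x).1 a).normalized_trace_mul_nonneg ((hQ y).1 b) d
    exact_mod_cast h0
  · have h1 : ((∑ a, ∑ b, p x y a b : ℝ) : ℂ) = 1 := by
      rw [Complex.ofReal_sum]
      simp_rw [hsumB, ← Finset.mul_sum, ← Matrix.trace_sum, (hP x).2, Matrix.trace_one]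
      simp [hd.ne']
    exact_mod_cast h1

end

/-! ### Matrices as operators on a finite-dimensional Hilbert space -/

section Operators

variable {H : Type*} [NormedAddCommGroup H] [InnerProductSpace ℂ H] [FiniteDimensional ℂ H]
  [CompleteSpace H] {n : Type*} [Fintype n] [DecidableEq n]

/-- The identification of matrices with operators by means of an orthonormal basis. -/
noncomputable def OrthonormalBasis.matrixEquiv (e : OrthonormalBasis n ℂ H) :
    Matrix n n ℂ ≃⋆ₐ[ℂ] (H →L[ℂ] H) :=
  (LinearMap.toMatrixOrthonormal e).symm.trans
    { LinearMap.toContinuousLinearMap with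
      map_mul' := fun _ _ => rfl
      map_star' := LinearMap.adjoint_toContinuousLinearMap }

theorem OrthonormalBasis.matrixEquiv_symm_apply (e : OrthonormalBasis n ℂ H) (T : H →L[ℂ] H)
    (i j : n) : e.matrixEquiv.symm T i j = inner ℂ (e i) (T (e j)) :=
  LinearMap.toMatrixOrthonormal_apply_apply e (T : H →ₗ[ℂ] H) i j

/-- The vector `∑ᵢ C eᵢ ⊗ eᵢ`. -/
noncomputable def OrthonormalBasis.vectorize (e : OrthonormalBasis n ℂ H) (C : Matrix n n ℂ) :
    HilbertTensor H H :=
  ((∑ i, e.matrixEquiv C (e i) ⊗ₜ[ℂ] e i : H ⊗[ℂ] H) : HilbertTensor H H)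

theorem OrthonormalBasis.inner_vectorize (e : OrthonormalBasis n ℂ H) (C : Matrix n n ℂ)
    (S T : H →L[ℂ] H) :
    inner ℂ (e.vectorize C) (tensorOp S T (e.vectorize C)) =
      (star C * e.matrixEquiv.symm S * C * (e.matrixEquiv.symm T).transpose).trace := by
  have h1 : tensorOp S T (e.vectorize C) =
      ((∑ j, S (e.matrixEquiv C (e j)) ⊗ₜ[ℂ] T (e j) : H ⊗[ℂ] H) : HilbertTensor H H) := by
    rw [OrthonormalBasis.vectorize, tensorOp]
    refine (Completion.map_coe (TensorProduct.mapL S T).uniformContinuous _).trans ?_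
    rw [map_sum]
    rfl
  have h2 : ∀ i j, inner ℂ (e.matrixEquiv C (e i)) (S (e.matrixEquiv C (e j))) =
      (star C * e.matrixEquiv.symm S * C) i j := fun i j => by
    rw [← ContinuousLinearMap.adjoint_inner_right, ← ContinuousLinearMap.star_eq_adjoint,
      ← map_star, ← mul_apply_eq_comp, ← mul_apply_eq_comp, ← e.matrixEquiv_symm_apply, map_mul,
      map_mul, StarAlgEquiv.symm_apply_apply, StarAlgEquiv.symm_apply_apply]
  rw [h1, OrthonormalBasis.vectorize, Completion.inner_coe, sum_inner]
  simp_rw [inner_sum, TensorProduct.inner_tmul, h2, ← e.matrixEquiv_symm_apply]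
  refine Finset.sum_congr rfl fun i _ => ?_
  rw [Matrix.diag_apply, Matrix.mul_apply]
  rfl

end Operators

theorem tensorOp_one {H K : Type*} [NormedAddCommGroup H] [InnerProductSpace ℂ H]
    [NormedAddCommGroup K] [InnerProductSpace ℂ K] :
    tensorOp (1 : H →L[ℂ] H) (1 : K →L[ℂ] K) = 1 := by
  ext ξ
  induction ξ using Completion.induction_on with
  | hp => exact isClosed_eq (by fun_prop) (by fun_prop)
  | ih ξ =>
    refine (Completion.map_coe (TensorProduct.mapL (1 : H →L[ℂ] H)
      (1 : K →L[ℂ] K)).uniformContinuous _).trans ?_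
    exact congrArg _ (congrArg (fun f : H ⊗[ℂ] K →L[ℂ] H ⊗[ℂ] K => f ξ) TensorProduct.mapL_id_id)

section Operators

variable {H : Type*} [NormedAddCommGroup H] [InnerProductSpace ℂ H] [FiniteDimensional ℂ H]
  [CompleteSpace H] {n : Type*} [Fintype n] [DecidableEq n]

theorem OrthonormalBasis.norm_vectorize_sq (e : OrthonormalBasis n ℂ H) (C : Matrix n n ℂ) :
    ((‖e.vectorize C‖ ^ 2 : ℝ) : ℂ) = (star C * C).trace := by
  have h := e.inner_vectorize C 1 1
  rw [tensorOp_one, one_apply_eq_self, map_one, mul_one, Matrix.transpose_one, mul_one] at h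
  rw [← h, inner_self_eq_norm_sq_to_K]
  norm_cast

theorem OrthonormalBasis.vectorize_eq_maxEntangled {d : ℕ} (e : OrthonormalBasis (Fin d) ℂ H) :
    e.vectorize ((((√(d : ℝ))⁻¹ : ℝ) : ℂ) • 1) = maxEntangled e := by
  rw [OrthonormalBasis.vectorize, maxEntangled, map_smul, map_one, Finset.smul_sum]
  rfl

/-- In a maximally entangled state, `S ⊗ T` has expectation `tr(S Tᵀ)`, the transpose being taken
in the basis that defines the state. -/
theorem OrthonormalBasis.inner_maxEntangled {d : ℕ} (e : OrthonormalBasis (Fin d) ℂ H)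
    (S T : H →L[ℂ] H) :
    inner ℂ (maxEntangled e) (tensorOp S T (maxEntangled e)) =
      (d : ℂ)⁻¹ * (e.matrixEquiv.symm S * (e.matrixEquiv.symm T).transpose).trace := by
  have hd : (((√(d : ℝ))⁻¹ : ℝ) : ℂ) * (((√(d : ℝ))⁻¹ : ℝ) : ℂ) = (d : ℂ)⁻¹ := by
    rw [← Complex.ofReal_mul, ← mul_inv, Real.mul_self_sqrt (Nat.cast_nonneg d),
      Complex.ofReal_inv, Complex.ofReal_natCast]
  rw [← e.vectorize_eq_maxEntangled, e.inner_vectorize, star_smul, star_one, RCLike.star_def,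
    Complex.conj_ofReal]
  simp only [smul_mul_assoc, mul_smul_comm, one_mul, mul_one, Matrix.trace_smul, smul_smul,
    smul_eq_mul, hd]

end Operators

/-- The standard basis of `ℂᵈ`, with the space placed in an arbitrary universe. -/
noncomputable def euclideanBasis (d : ℕ) :
    OrthonormalBasis (Fin d) ℂ (EuclideanSpace ℂ (ULift.{u} (Fin d))) :=
  (EuclideanSpace.basisFun (ULift.{u} (Fin d)) ℂ).reindex Equiv.ulift

section

variable {X Y A B : Type*} [Fintype A] [Fintype B] {p : Correlation X Y A B}

/-- The correlations of maximally entangled states are the trace correlations: transposition of the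
second PVM turns the one into the other. -/
theorem mem_maxEntangledCorrelations_iff :
    p ∈ maxEntangledCorrelations.{u} X Y A B ↔ IsTraceRealized p := by
  constructor
  · rintro ⟨H, _, _, _, d, e, hd, P, Q, hP, hQ, h⟩
    have : FiniteDimensional ℂ H := e.toBasis.finiteDimensional_of_finite
    refine ⟨d, fun x a => e.matrixEquiv.symm (P x a),
      fun y b => (e.matrixEquiv.symm (Q y b)).transpose, hd, fun x => (hP x).map _,
      fun y => ((hQ y).map _).transpose, fun x y a b => ?_⟩
    rw [h, e.inner_maxEntangled]
  · rintro ⟨d, P, Q, hd, hP, hQ, h⟩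
    let e := euclideanBasis.{u} d
    refine ⟨EuclideanSpace ℂ (ULift.{u} (Fin d)), inferInstance, inferInstance, inferInstance, d, e,
      hd, fun x a => e.matrixEquiv (P x a), fun y b => e.matrixEquiv (Q y b).transpose,
      fun x => (hP x).map _, fun y => (hQ y).transpose.map _, fun x y a b => ?_⟩
    rw [h, e.inner_maxEntangled, StarAlgEquiv.symm_apply_apply, StarAlgEquiv.symm_apply_apply,
      Matrix.transpose_transpose]

/-- The vectorization of `C` turns `tr(C* P C Q)` into a quantum correlation, with the transposes of
the `Q_{y,b}` as the second PVM. -/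
theorem mem_quantum_of_trace {d : ℕ} {P : X → A → Matrix (Fin d) (Fin d) ℂ}
    {Q : Y → B → Matrix (Fin d) (Fin d) ℂ} {C : Matrix (Fin d) (Fin d) ℂ}
    (hP : ∀ x, IsPVM (P x)) (hQ : ∀ y, IsPVM (Q y)) (hC : (star C * C).trace = 1)
    (h : ∀ x y a b, (p x y a b : ℂ) = (star C * P x a * C * Q y b).trace) :
    p ∈ quantum.{u} X Y A B := by
  let e := euclideanBasis.{u} d
  refine ⟨EuclideanSpace ℂ (ULift.{u} (Fin d)), inferInstance, inferInstance, inferInstance,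
    inferInstance, e.vectorize C, ?_, fun x a => e.matrixEquiv (P x a),
      fun y b => e.matrixEquiv (Q y b).transpose, fun x => (hP x).map _,
      fun y => (hQ y).transpose.map _, fun x y a b => ?_⟩
  · have h1 := e.norm_vectorize_sq C
    rw [hC] at h1
    have h2 : ‖e.vectorize C‖ ^ 2 = 1 := by exact_mod_cast h1
    nlinarith [norm_nonneg (e.vectorize C)]
  · rw [h, e.inner_vectorize, StarAlgEquiv.symm_apply_apply, StarAlgEquiv.symm_apply_apply,
      Matrix.transpose_transpose]

end

/-! ### Convex combinations of trace correlations -/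

section

variable {X Y A B : Type*} [Fintype A] [Fintype B]

theorem Game.convex_perfectStrategies (G : Game X Y A B) : Convex ℝ G.perfectStrategies := by
  rintro p ⟨hp, hp'⟩ q ⟨hq, hq'⟩ s t hs ht hst
  refine ⟨⟨fun x y y' a => ?_, fun x x' y b => ?_, fun x y a b => ?_, fun x y => ?_⟩,
    fun x y a b h => ?_⟩
  · simp [Finset.sum_add_distrib, ← Finset.mul_sum, hp.marginal_left x y y' a,
      hq.marginal_left x y y' a]
  · simp [Finset.sum_add_distrib, ← Finset.mul_sum, hp.marginal_right x x' y b,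
      hq.marginal_right x x' y b]
  · exact add_nonneg (mul_nonneg hs (hp.nonneg x y a b)) (mul_nonneg ht (hq.nonneg x y a b))
  · simp [Finset.sum_add_distrib, ← Finset.mul_sum, hp.sum_eq_one, hq.sum_eq_one, hst]
  · simp [hp' x y a b h, hq' x y a b h]

/-- The perfect strategies of a game form a face of the set of non-signalling correlations. -/
theorem Game.convexHull_inter_perfectStrategies (G : Game X Y A B) {s : Set (Correlation X Y A B)}
    (hs : ∀ p ∈ s, IsNonSignalling p) :
    convexHull ℝ s ∩ G.perfectStrategies = convexHull ℝ (s ∩ G.perfectStrategies) := by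
  refine subset_antisymm ?_ (Set.subset_inter (convexHull_mono Set.inter_subset_left)
    (convexHull_min Set.inter_subset_right G.convex_perfectStrategies))
  rintro p ⟨hp, -, hpG⟩
  obtain ⟨ι, _, w, z, hw, hw1, hz, hwz⟩ := mem_convexHull_iff_exists_fintype.1 hp
  have hz0 : ∀ i, w i ≠ 0 → z i ∈ s ∩ G.perfectStrategies := fun i hi => by
    refine ⟨hz i, hs _ (hz i), fun x y a b h => ?_⟩
    have h0 : ∑ i, w i * z i x y a b = 0 := by
      rw [← hpG x y a b h, ← hwz]
      simp [Finset.sum_apply]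
    have h1 := (Finset.sum_eq_zero_iff_of_nonneg fun i _ =>
      mul_nonneg (hw i) ((hs _ (hz i)).nonneg x y a b)).1 h0 i (Finset.mem_univ i)
    exact (mul_eq_zero.1 h1).resolve_left hi
  rw [← hwz, ← Finset.centerMass_eq_of_sum_1 _ _ hw1, ← Finset.centerMass_filter_ne_zero]
  refine Finset.centerMass_mem_convexHull _ (fun i _ => hw i) ?_ fun i hi =>
    hz0 i (Finset.mem_filter.1 hi).2
  rw [Finset.sum_filter_ne_zero, hw1]
  exact one_pos

end

section

variable {X Y A B : Type*} [Fintype A] [Fintype B]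

/-- PVMs satisfying the relations of the game extend to a representation of `C*(G)`. -/
theorem Game.exists_starAlgHom (G : Game X Y A B) {F : Type*} [CStarAlgebra F] {P : X → A → F}
    {Q : Y → B → F} (hP : ∀ x, IsPVM (P x)) (hQ : ∀ y, IsPVM (Q y))
    (h : ∀ x y a b, G.rule x y a b = 0 → P x a * Q y b = 0) :
    ∃ π : G.CStar →⋆ₐ[ℂ] F, (∀ x a, π (G.projA x a) = P x a) ∧
      ∀ y b, π (G.projB y b) = Q y b := by
  obtain ⟨π, hπ, -⟩ := UniversalCStar.existsUnique_lift G.relations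
    (Sum.elim (fun i => P i.1 i.2) fun i => Q i.1 i.2)
    (by rintro (i | i); exacts [(hP i.1).1 i.2, (hQ i.1).1 i.2])
    (by
      rintro r (⟨x, rfl⟩ | ⟨y, rfl⟩ | ⟨x, y, a, b, hr, rfl⟩)
      · simp [(hP x).2]
      · simp [(hQ y).2]
      · simp [h x y a b hr])
  exact ⟨π, fun x a => hπ (Sum.inl (x, a)), fun y b => hπ (Sum.inr (y, b))⟩

theorem Game.isPVM_projA (G : Game X Y A B) (x : X) : IsPVM (G.projA x) := by
  refine ⟨fun a => UniversalCStar.isStarProjection_gen _ _, ?_⟩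
  have h := UniversalCStar.lift_gen_relation G.relations (Or.inl ⟨x, rfl⟩)
  rw [map_sub, map_sum, map_one, sub_eq_zero] at h
  simp only [FreeStarAlg.lift_gen] at h
  exact h

theorem Game.isPVM_projB (G : Game X Y A B) (y : Y) : IsPVM (G.projB y) := by
  refine ⟨fun b => UniversalCStar.isStarProjection_gen _ _, ?_⟩
  have h := UniversalCStar.lift_gen_relation G.relations (Or.inr (Or.inl ⟨y, rfl⟩))
  rw [map_sub, map_sum, map_one, sub_eq_zero] at h
  simp only [FreeStarAlg.lift_gen] at h
  exact h

/-- A perfect finite convex combination of trace correlations comes from a tracial state on a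
direct sum of matrix algebras. -/
theorem Game.exists_tracialState (G : Game X Y A B) {p : Correlation X Y A B}
    (hp : p ∈ convexHull ℝ ({p | IsTraceRealized p} ∩ G.perfectStrategies)) :
    ∃ (F : Type v) (_ : CStarAlgebra F) (_ : FiniteDimensional ℂ F) (τ : F →ₗ[ℂ] ℂ)
      (π : G.CStar →⋆ₐ[ℂ] F), IsTracialState τ ∧
        ∀ x y a b, (p x y a b : ℂ) = τ (π (G.projA x a * G.projB y b)) := by
  obtain ⟨ι, _, w, z, hw, hw1, hz, hwz⟩ := mem_convexHull_iff_exists_fintype.1 hp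
  choose d P Q hd hP hQ hPQ using fun i => (hz i).1
  let κ := (Fintype.equivFin ι).symm
  let e := fun i => euclideanBasis.{v} (d (κ i))
  let F := fun i => EuclideanSpace ℂ (ULift.{v} (Fin (d (κ i)))) →L[ℂ]
    EuclideanSpace ℂ (ULift.{v} (Fin (d (κ i))))
  let c : Fin (Fintype.card ι) → ℝ := fun i => w (κ i) * (d (κ i) : ℝ)⁻¹
  have hc : ∀ i, 0 ≤ c i := fun i => mul_nonneg (hw _) (by positivity)
  let τ : (∀ i, F i) →ₗ[ℂ] ℂ := ∑ i, (c i : ℂ) •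
    (Matrix.traceLinearMap (Fin (d (κ i))) ℂ ℂ ∘ₗ
      ((e i).matrixEquiv.symm : F i ≃⋆ₐ[ℂ] _).toAlgEquiv.toLinearMap ∘ₗ LinearMap.proj i)
  have hτ : ∀ z, τ z = ∑ i, (c i : ℂ) * ((e i).matrixEquiv.symm (z i)).trace := fun z => by
    simp only [τ, LinearMap.sum_apply, LinearMap.smul_apply, smul_eq_mul]
    rfl
  obtain ⟨π, hπP, hπQ⟩ := G.exists_starAlgHom (F := ∀ i, F i)
    (P := fun x a i => (e i).matrixEquiv (P (κ i) x a))
    (Q := fun y b i => (e i).matrixEquiv (Q (κ i) y b))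
    (fun x => ⟨fun a => ⟨funext fun i => (((hP (κ i) x).map (e i).matrixEquiv).1 a).1,
      funext fun i => (((hP (κ i) x).map (e i).matrixEquiv).1 a).2⟩,
      funext fun i => (Finset.sum_apply _ _ _).trans ((hP (κ i) x).map (e i).matrixEquiv).2⟩)
    (fun y => ⟨fun b => ⟨funext fun i => (((hQ (κ i) y).map (e i).matrixEquiv).1 b).1,
      funext fun i => (((hQ (κ i) y).map (e i).matrixEquiv).1 b).2⟩,
      funext fun i => (Finset.sum_apply _ _ _).trans ((hQ (κ i) y).map (e i).matrixEquiv).2⟩)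
    (fun x y a b hr => funext fun i => by
      -- A vanishing trace `tr(PQ) = tr((PQ)* PQ)` forces `PQ = 0`.
      have h0 := hPQ (κ i) x y a b
      rw [(hz (κ i)).2.2 x y a b hr, Complex.ofReal_zero,
        ((hP (κ i) x).1 a).trace_mul_eq ((hQ (κ i) y).1 b)] at h0
      have h1 := (mul_eq_zero.1 h0.symm).resolve_left
        (inv_ne_zero (Nat.cast_ne_zero.2 (hd (κ i)).ne'))
      have h2 : P (κ i) x a * Q (κ i) y b = 0 :=
        Matrix.trace_conjTranspose_mul_self_eq_zero_iff.1 h1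
      change (e i).matrixEquiv _ * (e i).matrixEquiv _ = 0
      rw [← map_mul, h2, map_zero])
  refine ⟨∀ i, F i, inferInstance, inferInstance, τ, π, ⟨fun z => ?_, ?_, fun z z' => ?_⟩,
    fun x y a b => ?_⟩
  · rw [hτ]
    refine Finset.sum_nonneg fun i _ => mul_nonneg (Complex.zero_le_real.2 (hc i)) ?_
    rw [Pi.mul_apply, Pi.star_apply, map_mul, map_star]
    exact trace_star_mul_self_nonneg _
  · rw [hτ, ← Complex.ofReal_one, ← hw1, ← κ.sum_comp, Complex.ofReal_sum]
    refine Finset.sum_congr rfl fun i _ => ?_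
    have := (hd (κ i)).ne'
    rw [Pi.one_apply, map_one, Matrix.trace_one, Fintype.card_fin]
    simp [c, this]
  · simp_rw [hτ, Pi.mul_apply, map_mul, Matrix.trace_mul_comm ((e _).matrixEquiv.symm (z _))]
  · rw [map_mul, hπP, hπQ, hτ, ← hwz, ← κ.sum_comp]
    simp_rw [Finset.sum_apply, Pi.smul_apply, Complex.ofReal_sum]
    refine Finset.sum_congr rfl fun i _ => ?_
    rw [Pi.mul_apply, ← map_mul, StarAlgEquiv.symm_apply_apply, smul_eq_mul, Complex.ofReal_mul,
      hPQ]
    simp [c, mul_assoc]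

end

/-! ### Tracial states on finite-dimensional C*-algebras -/

section TracialState

variable {F : Type*} [CStarAlgebra F] [FiniteDimensional ℂ F]

/-- The GNS representation of a state on a finite-dimensional C*-algebra, in terms of matrices
acting on a finite-dimensional space. -/
theorem IsTracialState.exists_representation {τ : F →ₗ[ℂ] ℂ} (hτ : IsTracialState τ) :
    ∃ (n : ℕ) (L : F →⋆ₐ[ℂ] Matrix (Fin n) (Fin n) ℂ), (∀ z, τ (star z) = star (τ z)) ∧
      ∀ z, L z = 0 → τ z = 0 := by
  let _ : PartialOrder F := CStarAlgebra.spectralOrder F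
  have _ : StarOrderedRing F := CStarAlgebra.spectralOrderedRing F
  let f : F →ₚ[ℂ] ℂ := PositiveLinearMap.mk₀ τ fun z hz => by
    obtain ⟨y, rfl⟩ := CStarAlgebra.nonneg_iff_eq_star_mul_self.1 hz
    exact hτ.nonneg y
  have hf : ∀ z, f z = τ z := fun _ => rfl
  have : FiniteDimensional ℂ f.PreGNS := Module.Finite.equiv f.toPreGNS
  have hsurj : (Completion.toComplL (𝕜 := ℂ) (E := f.PreGNS)).range = ⊤ := by
    have h1 := Submodule.dense_iff_topologicalClosure_eq_top.1
      (show Dense ((Completion.toComplL (𝕜 := ℂ) (E := f.PreGNS)).range : Set f.GNS) from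
        Completion.denseRange_coe)
    rwa [(Submodule.closed_of_finiteDimensional _).submodule_topologicalClosure_eq] at h1
  have : FiniteDimensional ℂ f.GNS := Module.Finite.of_surjective
    (Completion.toComplL (𝕜 := ℂ) (E := f.PreGNS)).toLinearMap (LinearMap.range_eq_top.1 hsurj)
  let e := stdOrthonormalBasis ℂ f.GNS
  refine ⟨_, e.matrixEquiv.symm.toStarAlgHom.comp f.gnsStarAlgHom, fun z => map_star f z,
    fun z hz => ?_⟩
  have h1 : f.gnsStarAlgHom z = 0 := e.matrixEquiv.symm.injective (hz.trans (map_zero _).symm)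
  have h2 : ((f.toPreGNS z : f.PreGNS) : f.GNS) = 0 := by
    have := congrArg (fun T : f.GNS →L[ℂ] f.GNS => T (f.toPreGNS 1 : f.PreGNS)) h1
    simpa using this
  have h3 := congrArg (inner ℂ ((f.toPreGNS 1 : f.PreGNS) : f.GNS)) h2
  rw [Completion.inner_coe, inner_zero_right, PositiveLinearMap.preGNS_inner_def] at h3
  simpa [hf] using h3

open scoped MatrixOrder in
/-- A tracial state on a finite-dimensional C*-algebra is a matrix trace weighted by the square of
a matrix commuting with the algebra. -/
theorem IsTracialState.exists_trace {τ : F →ₗ[ℂ] ℂ} (hτ : IsTracialState τ) :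
    ∃ (n : ℕ) (L : F →⋆ₐ[ℂ] Matrix (Fin n) (Fin n) ℂ) (C : Matrix (Fin n) (Fin n) ℂ),
      IsSelfAdjoint C ∧ (∀ z, Commute C (L z)) ∧ ∀ z, τ z = (C * C * L z).trace := by
  obtain ⟨n, L, hstar, hL⟩ := hτ.exists_representation
  have hzero : ∀ z, (L z * L (star z)).trace = 0 → L z = 0 := fun z hz => by
    rw [map_star] at hz
    exact Matrix.trace_mul_conjTranspose_self_eq_zero_iff.1 hz
  -- `τ` is given by a density `d`, because the trace form is nondegenerate on the range of `L`.
  obtain ⟨d, hd⟩ : ∃ d, ∀ z, τ z = (L d * L z).trace := by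
    let W := LinearMap.range L.toLinearMap
    let t := Matrix.traceLinearMap (Fin n) ℂ ℂ
    let β : W →ₗ[ℂ] Module.Dual ℂ W := ((LinearMap.mul ℂ _).compr₂ t).domRestrict₁₂ W W
    have hβ : Function.Surjective β := by
      rw [← LinearMap.injective_iff_surjective_of_finrank_eq_finrank Subspace.dual_finrank_eq.symm]
      refine (injective_iff_map_eq_zero β).2 ?_
      rintro ⟨_, z, rfl⟩ hz
      exact Subtype.ext (hzero z (congrArg (fun g => g ⟨_, star z, rfl⟩) hz))
    have hτL : τ ∈ LinearMap.range L.toLinearMap.dualMap := by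
      rw [LinearMap.range_dualMap_eq_dualAnnihilator_ker, Submodule.mem_dualAnnihilator]
      exact hL
    obtain ⟨g, rfl⟩ := hτL
    obtain ⟨⟨_, d, rfl⟩, hd⟩ := hβ (g.domRestrict W)
    exact ⟨d, fun z => (congrArg (fun g => g ⟨_, z, rfl⟩) hd).symm⟩
  -- Since `τ` is self-adjoint, the real part of a density is again one.
  obtain ⟨d, hdsa, hd⟩ : ∃ d, IsSelfAdjoint d ∧ ∀ z, τ z = (L d * L z).trace := by
    have h1 : ∀ z, τ z = (L (star d) * L z).trace := fun z => by
      rw [← star_star z, hstar, hd, ← Matrix.trace_conjTranspose, ← Matrix.star_eq_conjTranspose,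
        star_mul, ← map_star, ← map_star, Matrix.trace_mul_comm]
    refine ⟨(2⁻¹ : ℂ) • (d + star d), ?_, fun z => ?_⟩
    · rw [IsSelfAdjoint, star_smul, star_add, star_star, add_comm]
      simp
    · rw [map_smul, map_add, smul_mul_assoc, Matrix.trace_smul, add_mul, Matrix.trace_add, ← hd,
        ← h1, smul_eq_mul]
      ring
  -- Traciality of `τ` makes the density central in the image of `L`.
  have hcomm : ∀ z, Commute (L d) (L z) := fun z => by
    rw [Commute, SemiconjBy, ← sub_eq_zero, ← map_mul, ← map_mul, ← map_sub]
    refine hzero _ ?_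
    generalize star (d * z - z * d) = w
    rw [map_sub, sub_mul, Matrix.trace_sub, map_mul, map_mul, mul_assoc, ← map_mul, ← hd,
      mul_assoc, Matrix.trace_mul_comm, mul_assoc, ← map_mul, ← hd, hτ.tracial, sub_self]
  let _ : PartialOrder F := CStarAlgebra.spectralOrder F
  have _ : StarOrderedRing F := CStarAlgebra.spectralOrderedRing F
  -- The negative part of `d` satisfies `0 ≤ τ(d⁻) = -tr(L(d⁻)²) ≤ 0`.
  have hneg : L d⁻ = 0 := by
    obtain ⟨y, hy⟩ := CStarAlgebra.nonneg_iff_eq_star_mul_self.1 (CFC.negPart_nonneg d)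
    have hsa : star d⁻ = d⁻ := (CFC.negPart_nonneg d).isSelfAdjoint.star_eq
    have h1 : d * d⁻ = -(d⁻ * d⁻) := by
      nth_rewrite 1 [← CFC.posPart_sub_negPart d hdsa]
      rw [sub_mul, CFC.posPart_mul_negPart, zero_sub]
    have h2 : 0 ≤ τ d⁻ := hy ▸ hτ.nonneg y
    rw [hd, ← map_mul, h1, map_neg, Matrix.trace_neg, map_mul] at h2
    have h3 := trace_star_mul_self_nonneg (L d⁻)
    rw [← map_star, hsa] at h3
    refine hzero _ ?_
    rw [hsa]
    exact le_antisymm (neg_nonneg.1 h2) h3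
  have hpos : 0 ≤ L d := by
    obtain ⟨y, hy⟩ := CStarAlgebra.nonneg_iff_eq_star_mul_self.1 (CFC.posPart_nonneg d)
    rw [← CFC.posPart_sub_negPart d hdsa, map_sub, hneg, sub_zero, hy, map_mul, map_star]
    exact star_mul_self_nonneg _
  refine ⟨n, L, CFC.sqrt (L d), (CFC.sqrt_nonneg _).isSelfAdjoint,
    fun z => (hcomm z).cfcₙ_nnreal _, fun z => ?_⟩
  rw [CFC.sqrt_mul_sqrt_self _ hpos, hd]

end TracialState

section

variable {X Y A B : Type*} [Fintype A] [Fintype B]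

/-- Correlations coming from a tracial state on a finite-dimensional quotient of `C*(G)` are
perfect quantum strategies: with `τ = tr(C · C)` and `C` in the commutant, the vectorization of `C`
is the required state. -/
theorem Game.mem_quantum_of_tracialState (G : Game X Y A B) {p : Correlation X Y A B}
    {F : Type*} [CStarAlgebra F] [FiniteDimensional ℂ F] {τ : F →ₗ[ℂ] ℂ} {π : G.CStar →⋆ₐ[ℂ] F}
    (hτ : IsTracialState τ) (h : ∀ x y a b, (p x y a b : ℂ) = τ (π (G.projA x a * G.projB y b))) :
    p ∈ quantum.{u} X Y A B := by
  obtain ⟨n, L, C, hC, hCL, hL⟩ := hτ.exists_trace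
  refine mem_quantum_of_trace (C := C) (fun x => (G.isPVM_projA x).map (L.comp π))
    (fun y => (G.isPVM_projB y).map (L.comp π)) ?_ fun x y a b => ?_
  · rw [hC.star_eq, ← mul_one (C * C), ← map_one L, ← hL, hτ.map_one]
  · rw [h, hL, hC.star_eq, map_mul, map_mul, StarAlgHom.comp_apply, StarAlgHom.comp_apply,
      mul_assoc C (L _) C, ← (hCL _).eq, ← mul_assoc, ← mul_assoc]

theorem Game.projA_mul_projB_eq_zero (G : Game X Y A B) {x : X} {y : Y} {a : A} {b : B}
    (h : G.rule x y a b = 0) : G.projA x a * G.projB y b = 0 := by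
  have h := UniversalCStar.lift_gen_relation G.relations (Or.inr (Or.inr ⟨x, y, a, b, h, rfl⟩))
  rw [map_mul, FreeStarAlg.lift_gen, FreeStarAlg.lift_gen] at h
  exact h

end

/-! ### Vectors in a tensor product as conjugate-linear operators -/

section Slice

variable {H K : Type*} [NormedAddCommGroup H] [InnerProductSpace ℂ H]
  [NormedAddCommGroup K] [InnerProductSpace ℂ K]

namespace HilbertTensor

/-- The bilinear map `(u, v) ↦ u ⊗ v` to the Hilbert space tensor product. -/
noncomputable def tmulL (H K : Type*) [NormedAddCommGroup H] [InnerProductSpace ℂ H]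
    [NormedAddCommGroup K] [InnerProductSpace ℂ K] : H →L[ℂ] K →L[ℂ] HilbertTensor H K :=
  (ContinuousLinearMap.compL ℂ K (H ⊗[ℂ] K) (HilbertTensor H K) Completion.toComplL).comp
    (TensorProduct.mkL ℂ H K)

theorem tmulL_apply (u : H) (v : K) :
    tmulL H K u v = ((u ⊗ₜ[ℂ] v : H ⊗[ℂ] K) : HilbertTensor H K) := rfl

theorem inner_tmulL (u u' : H) (v v' : K) :
    inner ℂ (tmulL H K u v) (tmulL H K u' v') = inner ℂ u u' * inner ℂ v v' := by
  rw [tmulL_apply, tmulL_apply, Completion.inner_coe, TensorProduct.inner_tmul]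

theorem tensorOp_tmulL (S : H →L[ℂ] H) (T : K →L[ℂ] K) (u : H) (v : K) :
    tensorOp S T (tmulL H K u v) = tmulL H K (S u) (T v) :=
  tensorOp_tmul S T u v

/-- Induction on a vector of the Hilbert space tensor product. -/
theorem induction_tmul {motive : HilbertTensor H K → Prop} (ξ : HilbertTensor H K)
    (closed : IsClosed {ξ | motive ξ}) (zero : motive 0) (tmul : ∀ u v, motive (tmulL H K u v))
    (add : ∀ ξ η, motive ξ → motive η → motive (ξ + η)) : motive ξ := by
  refine Completion.induction_on ξ closed fun ξ => ?_
  induction ξ with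
  | zero => rw [Completion.coe_zero]; exact zero
  | tmul u v => exact tmul u v
  | add ξ η h1 h2 => rw [Completion.coe_add]; exact add _ _ h1 h2

theorem ext_inner_tmulL {ξ η : HilbertTensor H K}
    (h : ∀ u v, inner ℂ (tmulL H K u v) ξ = inner ℂ (tmulL H K u v) η) : ξ = η := by
  refine ext_inner_left ℂ fun ζ => ?_
  induction ζ using induction_tmul with
  | closed => exact isClosed_eq (by fun_prop) (by fun_prop)
  | zero => simp
  | tmul u v => exact h u v
  | add ξ η h1 h2 => rw [inner_add_left, inner_add_left, h1, h2]

theorem tensorOp_tensorOp (S S' : H →L[ℂ] H) (T T' : K →L[ℂ] K) (ξ : HilbertTensor H K) :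
    tensorOp S T (tensorOp S' T' ξ) = tensorOp (S * S') (T * T') ξ := by
  induction ξ using induction_tmul with
  | closed => exact isClosed_eq (by fun_prop) (by fun_prop)
  | zero => simp
  | tmul u v => simp_rw [tensorOp_tmulL, mul_apply_eq_comp]
  | add ξ ξ' h1 h2 => rw [map_add, map_add, map_add, h1, h2]

section Slices

variable [CompleteSpace K]

/-- The conjugate-linear operator associated with `ξ ∈ H ⊗ K`, which sends `u ∈ H` to the vector
`⟨u| ⊗ 1` applied to `ξ`. -/
noncomputable def slice : HilbertTensor H K →L[ℂ] H →L⋆[ℂ] K :=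
  ContinuousLinearMap.flip
    (((ContinuousLinearMap.adjoint (𝕜 := ℂ) (E := K)
      (F := HilbertTensor H K)).toLinearIsometry.toContinuousLinearMap).comp (tmulL H K))

theorem inner_slice (ξ : HilbertTensor H K) (u : H) (v : K) :
    inner ℂ v (slice ξ u) = inner ℂ (tmulL H K u v) ξ :=
  ContinuousLinearMap.adjoint_inner_right (tmulL H K u) v ξ

theorem isCompactOperator_slice (ξ : HilbertTensor H K) : IsCompactOperator (slice ξ) := by
  induction ξ using induction_tmul with
  | closed =>
    exact isClosed_setOfPred_isCompactOperator.preimage (slice (H := H) (K := K)).continuous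
  | zero => rw [map_zero]; exact isCompactOperator_zero
  | tmul x v =>
    have h : ⇑(slice (tmulL H K x v)) =
        ⇑(ContinuousLinearMap.toSpanSingleton ℂ v) ∘ ⇑((innerSL ℂ (E := H)).flip x) := by
      funext u
      refine ext_inner_left ℂ fun w => ?_
      simp [inner_slice, inner_tmulL, inner_smul_right]
    rw [h]
    exact (isCompactOperator_of_locallyCompactSpace_dom ((innerSL ℂ (E := H)).flip x)).clm_comp _
  | add ξ η h1 h2 => rw [map_add]; exact h1.add h2

end Slices

section SlicesRight

variable [CompleteSpace H]

/-- The conjugate-linear operator associated with `ξ ∈ H ⊗ K`, which sends `v ∈ K` to the vector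
`1 ⊗ ⟨v|` applied to `ξ`. -/
noncomputable def sliceRight : HilbertTensor H K →L[ℂ] K →L⋆[ℂ] H :=
  ContinuousLinearMap.flip
    (((ContinuousLinearMap.adjoint (𝕜 := ℂ) (E := H)
      (F := HilbertTensor H K)).toLinearIsometry.toContinuousLinearMap).comp (tmulL H K).flip)

theorem inner_sliceRight (ξ : HilbertTensor H K) (u : H) (v : K) :
    inner ℂ u (sliceRight ξ v) = inner ℂ (tmulL H K u v) ξ :=
  ContinuousLinearMap.adjoint_inner_right ((tmulL H K).flip v) u ξ

end SlicesRight

variable [CompleteSpace H] [CompleteSpace K]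

theorem inner_tmulL_tensorOp (S : H →L[ℂ] H) (T : K →L[ℂ] K) (u : H) (v : K)
    (ξ : HilbertTensor H K) :
    inner ℂ (tmulL H K u v) (tensorOp S T ξ) = inner ℂ (tmulL H K (star S u) (star T v)) ξ := by
  induction ξ using induction_tmul with
  | closed => exact isClosed_eq (by fun_prop) (by fun_prop)
  | zero => simp
  | tmul u' v' =>
    simp_rw [tensorOp_tmulL, inner_tmulL, ContinuousLinearMap.star_eq_adjoint,
      ContinuousLinearMap.adjoint_inner_left]
  | add ξ η h1 h2 => rw [map_add, inner_add_right, inner_add_right, h1, h2]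

theorem inner_tensorOp_left (S : H →L[ℂ] H) (T : K →L[ℂ] K) (ξ η : HilbertTensor H K) :
    inner ℂ (tensorOp S T ξ) η = inner ℂ ξ (tensorOp (star S) (star T) η) := by
  induction ξ using induction_tmul with
  | closed => exact isClosed_eq (by fun_prop) (by fun_prop)
  | zero => simp
  | tmul u v => rw [tensorOp_tmulL, inner_tmulL_tensorOp, star_star, star_star]
  | add ξ ξ' h1 h2 => rw [map_add, inner_add_left, inner_add_left, h1, h2]

/-- A product projection annihilates every state in which it has zero expectation. -/
theorem tensorOp_eq_zero {S : H →L[ℂ] H} {T : K →L[ℂ] K} (hS : IsStarProjection S)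
    (hT : IsStarProjection T) {ξ : HilbertTensor H K} (h : inner ℂ ξ (tensorOp S T ξ) = 0) :
    tensorOp S T ξ = 0 := by
  rw [← inner_self_eq_zero (𝕜 := ℂ), inner_tensorOp_left, tensorOp_tensorOp,
    hS.isSelfAdjoint.star_eq, hT.isSelfAdjoint.star_eq, hS.isIdempotentElem.eq,
    hT.isIdempotentElem.eq, h]

theorem slice_tensorOp (S : H →L[ℂ] H) (T : K →L[ℂ] K) (ξ : HilbertTensor H K) (u : H) :
    slice (tensorOp S T ξ) u = T (slice ξ (star S u)) := by
  refine ext_inner_left ℂ fun v => ?_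
  rw [inner_slice, inner_tmulL_tensorOp, ← inner_slice, ContinuousLinearMap.star_eq_adjoint T,
    ContinuousLinearMap.adjoint_inner_left]

theorem sliceRight_tensorOp (S : H →L[ℂ] H) (T : K →L[ℂ] K) (ξ : HilbertTensor H K) (v : K) :
    sliceRight (tensorOp S T ξ) v = S (sliceRight ξ (star T v)) := by
  refine ext_inner_left ℂ fun u => ?_
  rw [inner_sliceRight, inner_tmulL_tensorOp, ← inner_sliceRight,
    ContinuousLinearMap.star_eq_adjoint S, ContinuousLinearMap.adjoint_inner_left]

/-- Parseval's identity for `ξ ∈ H ⊗ K` with respect to an orthonormal family in `H` off whose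
span the operator associated with `ξ` vanishes. -/
theorem hasSum_inner_slice {ι : Type*} {u : ι → H} (hu : Orthonormal ℂ u)
    {ξ : HilbertTensor H K} (hξ : ∀ w, (∀ k, inner ℂ (u k) w = 0) → slice ξ w = 0)
    (η : HilbertTensor H K) :
    HasSum (fun k => inner ℂ (slice ξ (u k)) (slice η (u k))) (inner ℂ ξ η) := by
  classical
  let V : ι → K →ₗᵢ[ℂ] HilbertTensor H K := fun k =>
    { (tmulL H K (u k)).toLinearMap with
      norm_map' := fun v => by
        refine (Completion.norm_coe _).trans ((TensorProduct.norm_tmul (u k) v).trans ?_)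
        rw [hu.1 k, one_mul] }
  have hVa : ∀ k v, V k v = tmulL H K (u k) v := fun _ _ => rfl
  have hV : OrthogonalFamily ℂ (fun _ => K) V := fun i j hij v w => by
    rw [hVa, hVa, inner_tmulL, hu.2 hij, zero_mul]
  have hmem : ξ ∈ (⨆ k, LinearMap.range (V k).toLinearMap).topologicalClosure := by
    rw [← Submodule.orthogonal_orthogonal_eq_closure, Submodule.mem_orthogonal]
    intro ζ hζ
    -- With `Π` the projection onto the closed span of the family, `ξ = (Π ⊗ 1) ξ`.
    let M : Submodule ℂ H := (Submodule.span ℂ (Set.range u)).topologicalClosure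
    have : CompleteSpace M := (Submodule.isClosed_topologicalClosure _).completeSpace_coe
    have hζM : ∀ x ∈ M, ∀ v, inner ℂ ζ (tmulL H K x v) = 0 := fun x hx v => by
      let φ : H →L[ℂ] ℂ := (innerSL ℂ ζ).comp ((tmulL H K).flip v)
      have hM : M ≤ LinearMap.ker φ.toLinearMap := by
        refine Submodule.topologicalClosure_minimal _ (Submodule.span_le.2 ?_) φ.isClosed_ker
        rintro _ ⟨k, rfl⟩
        exact inner_eq_zero_symm.1 (hζ _ (Submodule.mem_iSup_of_mem k ⟨v, rfl⟩))
      exact hM hx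
    have hζ0 : ∀ η, inner ℂ ζ (tensorOp M.starProjection (1 : K →L[ℂ] K) η) = 0 := fun η => by
      induction η using induction_tmul with
      | closed => exact isClosed_eq (by fun_prop) (by fun_prop)
      | zero => simp
      | tmul x v => rw [tensorOp_tmulL]; exact hζM _ (M.starProjection_apply_mem x) _
      | add η η' h1 h2 => rw [map_add, inner_add_right, h1, h2, add_zero]
    have hξM : tensorOp M.starProjection (1 : K →L[ℂ] K) ξ = ξ := by
      refine ext_inner_tmulL fun x v => ?_
      have h0 : slice ξ (x - M.starProjection x) = 0 := hξ _ fun k =>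
        M.sub_starProjection_mem_orthogonal x _
          (Submodule.le_topologicalClosure _ (Submodule.subset_span ⟨k, rfl⟩))
      rw [map_sub, sub_eq_zero] at h0
      rw [← inner_slice, slice_tensorOp, isStarProjection_starProjection.isSelfAdjoint.star_eq,
        ← h0, one_apply_eq_self, inner_slice]
    rw [← hξM]
    exact hζ0 ξ
  rw [← hV.range_linearIsometry] at hmem
  obtain ⟨w, rfl⟩ := hmem
  have hw : ∀ k, slice (hV.linearIsometry w) (u k) = w k := fun k => by
    refine ext_inner_left ℂ fun v => ?_
    rw [inner_slice, ← hVa, ← hV.linearIsometry_apply_single, LinearIsometry.inner_map_map,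
      lp.inner_single_left]
  have hsum := ((innerSL ℂ (E := HilbertTensor H K)).flip η).hasSum (hV.hasSum_linearIsometry w)
  have hterm : ∀ k, (innerSL ℂ (E := HilbertTensor H K)).flip η (V k (w k)) =
      inner ℂ (slice (hV.linearIsometry w) (u k)) (slice η (u k)) := fun k => by
    rw [hw, ContinuousLinearMap.flip_apply, innerSL_apply_apply, inner_slice, hVa]
  simp only [hterm] at hsum
  exact hsum

end HilbertTensor

end Slice

/-! ### Compressions to invariant subspaces -/

section Compression

variable {H : Type*} [NormedAddCommGroup H] [InnerProductSpace ℂ H] {n : Type*} [Fintype n]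

/-- The matrix of the compression of an operator to a subspace, in an orthonormal basis. -/
noncomputable def OrthonormalBasis.compress {E : Submodule ℂ H} (e : OrthonormalBasis n ℂ E) :
    (H →L[ℂ] H) →ₗ[ℂ] Matrix n n ℂ where
  toFun T := Matrix.of fun i j => inner ℂ (e i : H) (T (e j))
  map_add' S T := by ext i j; simp
  map_smul' c T := by ext i j; simp

namespace OrthonormalBasis

variable {E : Submodule ℂ H} (e : OrthonormalBasis n ℂ E)

theorem compress_apply (T : H →L[ℂ] H) (i j : n) :
    e.compress T i j = inner ℂ (e i : H) (T (e j)) := rfl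

theorem compress_mul (S : H →L[ℂ] H) {T : H →L[ℂ] H} (hT : ∀ w ∈ E, T w ∈ E) :
    e.compress (S * T) = e.compress S * e.compress T := by
  ext i j
  have h := congrArg (fun w : E => inner ℂ (e i : H) (S w)) (e.sum_repr' ⟨_, hT _ (e j).2⟩)
  simp only [Submodule.coe_sum, Submodule.coe_smul, map_sum, map_smul, inner_sum, inner_smul_right,
    Submodule.coe_inner] at h
  rw [compress_apply, mul_apply_eq_comp, ← h, Matrix.mul_apply]
  exact Finset.sum_congr rfl fun k _ => mul_comm _ _

theorem compress_one [DecidableEq n] : e.compress 1 = 1 := by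
  ext i j
  rw [compress_apply, one_apply_eq_self, Matrix.one_apply, ← Submodule.coe_inner,
    orthonormal_iff_ite.1 e.orthonormal]

theorem compress_star [CompleteSpace H] (T : H →L[ℂ] H) :
    e.compress (star T) = star (e.compress T) := by
  ext i j
  rw [Matrix.star_apply, compress_apply, compress_apply, ContinuousLinearMap.star_eq_adjoint,
    ContinuousLinearMap.adjoint_inner_right, RCLike.star_def, inner_conj_symm]

end OrthonormalBasis

end Compression

theorem mapsTo_eigenspace {H : Type*} [NormedAddCommGroup H] [InnerProductSpace ℂ H]
    {R T : H →L[ℂ] H} (h : Commute R T) (μ : ℂ) :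
    ∀ w ∈ Module.End.eigenspace (R : Module.End ℂ H) μ,
      T w ∈ Module.End.eigenspace (R : Module.End ℂ H) μ := by
  intro w hw
  rw [Module.End.mem_eigenspace_iff] at hw ⊢
  change R w = μ • w at hw
  change R (T w) = μ • T w
  rw [← mul_apply_eq_comp, h.eq, mul_apply_eq_comp, hw, map_smul]

/-- An element commutes with the members of a PVM if its off-diagonal corners vanish. -/
theorem IsPVM.commute {ι M : Type*} [Fintype ι] [Semiring M] [Star M] {P : ι → M} (hP : IsPVM P)
    {r : M} (h : ∀ i j, i ≠ j → P i * r * P j = 0) (i : ι) : Commute (P i) r := by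
  classical
  have h1 : P i * r = P i * r * P i := by
    conv_lhs => rw [← mul_one (P i * r), ← hP.2, Finset.mul_sum]
    exact Finset.sum_eq_single i (fun j _ hj => h i j hj.symm) (by simp)
  have h2 : r * P i = P i * r * P i := by
    conv_lhs => rw [← one_mul (r * P i), ← hP.2, Finset.sum_mul]
    simp_rw [← mul_assoc]
    exact Finset.sum_eq_single i (fun j _ hj => h j i hj) (by simp)
  exact h1.trans h2.symm

/-! ### Products of two conjugate-linear operators -/

section ConjugateLinear

variable {H : Type*} [NormedAddCommGroup H] [InnerProductSpace ℂ H]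
  {A B : Type*} [Fintype A] [Fintype B] {S T : H →L⋆[ℂ] H}

/-- Inserting the resolution of the identity `∑ Q_b² = 1` between `T` and `S` shows that
`V T S W = 0` if for each `b` one of `V T Q_b` and `Q_b S W` vanishes. -/
theorem mul_comp_mul_eq_zero [CompleteSpace H] {Q : B → H →L[ℂ] H} (hQ : IsPVM Q)
    {V W : H →L[ℂ] H} (h : ∀ b, (∀ v, V (T (Q b v)) = 0) ∨ ∀ u, Q b (S (W u)) = 0) :
    V * T.comp S * W = 0 := by
  ext u
  have h1 : S (W u) = ∑ b, Q b (Q b (S (W u))) := by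
    have h2 : ∀ b, Q b (Q b (S (W u))) = Q b (S (W u)) := fun b => by
      rw [← mul_apply_eq_comp, (hQ.1 b).isIdempotentElem.eq]
    simp_rw [h2, ← _root_.sum_apply, hQ.2]
    rfl
  change V (T (S (W u))) = 0
  rw [h1, map_sum, map_sum]
  refine Finset.sum_eq_zero fun b _ => ?_
  rcases h b with h2 | h2
  · exact h2 _
  · rw [h2, map_zero, map_zero, map_zero]

/-- If the conjugate-linear operators `S` and `T` are adjoint to each other, then `R` sandwiched
between vectors in the range of `S` can be rewritten through `T ∘ R ∘ S`. -/
theorem inner_comp_comp (hST : ∀ u v, inner ℂ v (S u) = inner ℂ u (T v)) (R : H →L[ℂ] H) (u w : H) :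
    inner ℂ (S u) (R (S w)) = inner ℂ (T (R (S w))) u := by
  rw [← inner_conj_symm, hST, inner_conj_symm]

theorem star_comp_comp [CompleteSpace H] (hST : ∀ u v, inner ℂ v (S u) = inner ℂ u (T v))
    (R : H →L[ℂ] H) :
    star (T.comp (R.comp S) : H →L[ℂ] H) = T.comp ((star R).comp S) := by
  refine ((ContinuousLinearMap.eq_adjoint_iff _ _).2 fun u w => ?_).symm
  change inner ℂ (T (star R (S u))) w = inner ℂ u (T (R (S w)))
  rw [← inner_comp_comp hST, ← hST, ContinuousLinearMap.star_eq_adjoint,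
    ContinuousLinearMap.adjoint_inner_right]

/-- If `R` is idempotent and commutes with `S T`, then `(T R S)² = (T R S)(T S)`: the operator
`T R S` is idempotent up to the scalar by which `T S` acts on an eigenspace. -/
theorem comp_comp_mul_self {R : H →L[ℂ] H} (hR : IsIdempotentElem R)
    (h : Commute R (S.comp T : H →L[ℂ] H)) :
    (T.comp (R.comp S) * T.comp (R.comp S) : H →L[ℂ] H) =
      T.comp (R.comp S) * (T.comp S : H →L[ℂ] H) := by
  ext u
  have h1 : ∀ v, R (S (T v)) = S (T (R v)) := fun v =>
    congrArg (fun R : H →L[ℂ] H => R v) h.eq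
  change T (R (S (T (R (S u))))) = T (R (S (T (S u))))
  rw [← h1, ← mul_apply_eq_comp R R, hR.eq]

theorem commute_comp_comp {R : H →L[ℂ] H} (h : Commute R (S.comp T : H →L[ℂ] H)) :
    Commute (T.comp S : H →L[ℂ] H) (T.comp (R.comp S)) := by
  ext u
  have h1 : ∀ v, R (S (T v)) = S (T (R v)) := fun v =>
    congrArg (fun R : H →L[ℂ] H => R v) h.eq
  change T (S (T (R (S u)))) = T (R (S (T (S u))))
  rw [h1]

theorem isSelfAdjoint_comp [CompleteSpace H] (hST : ∀ u v, inner ℂ v (S u) = inner ℂ u (T v)) :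
    IsSelfAdjoint (T.comp S : H →L[ℂ] H) := by
  have h := star_comp_comp hST 1
  rwa [star_one] at h

theorem inner_comp_self (hST : ∀ u v, inner ℂ v (S u) = inner ℂ u (T v)) (u : H) :
    inner ℂ u (T (S u)) = (‖S u‖ : ℂ) ^ 2 := by
  rw [← hST, inner_self_eq_norm_sq_to_K]
  rfl

section Eigenspace

variable {n : Type*} [Fintype n] [DecidableEq n] {μ : ℂ}
  (e : OrthonormalBasis n ℂ (Module.End.eigenspace ((T.comp S : H →L[ℂ] H) : Module.End ℂ H) μ))

theorem OrthonormalBasis.compress_comp_self : e.compress (T.comp S) = μ • 1 := by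
  rw [← e.compress_one, ← map_smul]
  ext i j
  have h : (T.comp S : H →L[ℂ] H) (e j) = μ • (e j : H) :=
    Module.End.mem_eigenspace_iff.1 (e j).2
  rw [e.compress_apply, e.compress_apply, h]
  rfl

variable [CompleteSpace H]

theorem IsPVM.compress {P : A → H →L[ℂ] H} (hP : IsPVM P)
    (h : ∀ a, Commute (P a) (T.comp S : H →L[ℂ] H)) : IsPVM fun a => e.compress (P a) := by
  refine ⟨fun a => ⟨?_, ?_⟩, ?_⟩
  · rw [IsIdempotentElem, ← e.compress_mul _ (mapsTo_eigenspace (h a).symm μ),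
      (hP.1 a).isIdempotentElem.eq]
  · rw [IsSelfAdjoint, ← e.compress_star, (hP.1 a).isSelfAdjoint.star_eq]
  · rw [← map_sum, hP.2, e.compress_one]

/-- On the eigenspace of `T S` for the eigenvalue `μ ≠ 0`, the operators `μ⁻¹ T Q_b S` form a
PVM whenever the `Q_b` do and commute with `S T`. -/
theorem IsPVM.compress_comp_comp (hST : ∀ u v, inner ℂ v (S u) = inner ℂ u (T v))
    {Q : B → H →L[ℂ] H} (hQ : IsPVM Q) (h : ∀ b, Commute (Q b) (S.comp T : H →L[ℂ] H))
    (hμ : μ ≠ 0) (hμr : star μ = μ) :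
    IsPVM fun b => μ⁻¹ • e.compress (T.comp ((Q b).comp S)) := by
  refine ⟨fun b => ⟨?_, ?_⟩, ?_⟩
  · have h1 : e.compress (T.comp ((Q b).comp S)) * e.compress (T.comp ((Q b).comp S)) =
        μ • e.compress (T.comp ((Q b).comp S)) := by
      rw [← e.compress_mul _ (mapsTo_eigenspace (commute_comp_comp (h b)) μ),
        comp_comp_mul_self (hQ.1 b).isIdempotentElem (h b),
        e.compress_mul _ (mapsTo_eigenspace (Commute.refl _) μ), e.compress_comp_self,
        mul_smul_comm, mul_one]
    rw [IsIdempotentElem, smul_mul_smul_comm, h1, smul_smul, mul_assoc, inv_mul_cancel₀ hμ, mul_one]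
  · rw [IsSelfAdjoint, star_smul, ← e.compress_star, star_comp_comp hST,
      (hQ.1 b).isSelfAdjoint.star_eq, star_inv₀, hμr]
  · have h1 : ∑ b, (T.comp ((Q b).comp S) : H →L[ℂ] H) = T.comp S := by
      ext u
      have h2 := congrArg (fun R : H →L[ℂ] H => T (R (S u))) hQ.2
      simpa [_root_.sum_apply, map_sum] using h2
    rw [← Finset.smul_sum, ← map_sum, h1, e.compress_comp_self, smul_smul, inv_mul_cancel₀ hμ,
      one_smul]

end Eigenspace

end ConjugateLinear

/-! ### Spectral decomposition of the reduced density operator -/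

section Spectral

open Module.End

variable {H : Type*} [NormedAddCommGroup H] [InnerProductSpace ℂ H] [CompleteSpace H]

/-- The nonzero eigenvalues of an operator. -/
abbrev NonzeroEigenvalue (R : H →L[ℂ] H) : Type :=
  {μ : ℂ // μ ≠ 0 ∧ HasEigenvalue (R : Module.End ℂ H) μ}

/-- A compact self-adjoint operator annihilates the orthogonal complement of the eigenspaces for
nonzero eigenvalues. -/
theorem IsCompactOperator.apply_eq_zero_of_inner_eq_zero {R : H →L[ℂ] H}
    (hc : IsCompactOperator R) (hR : IsSelfAdjoint R) {w : H}
    (hw : ∀ μ : NonzeroEigenvalue R, ∀ u ∈ eigenspace (R : Module.End ℂ H) μ.1,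
      inner ℂ u w = 0) : R w = 0 := by
  have hsymm := hR.isSymmetric
  have h : R w ∈ (⨆ μ, eigenspace (R : Module.End ℂ H) μ)ᗮ := by
    rw [← Submodule.iInf_orthogonal, Submodule.mem_iInf]
    intro μ u hu
    have h1 : R u = μ • u := mem_eigenspace_iff.1 hu
    have h2 : inner ℂ u (R w) = inner ℂ (R u) w := (hsymm u w).symm
    rw [h2, h1, inner_smul_left]
    by_cases hμ : μ = 0
    · rw [hμ, map_zero, zero_mul]
    by_cases hu0 : u = 0
    · rw [hu0, inner_zero_left, mul_zero]
    · rw [hw ⟨μ, hμ, hasEigenvalue_of_hasEigenvector ⟨hu, hu0⟩⟩ u hu, mul_zero]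
  rwa [ContinuousLinearMap.orthogonalComplement_iSup_eigenspaces_eq_bot hc hsymm,
    Submodule.mem_bot] at h

end Spectral

section

variable {X Y A B : Type*} [Fintype X] [Fintype Y] [Fintype A] [Fintype B]

theorem eq_zero_or_eq_zero_of_sum_mul_eq_zero {ι : Type*} [Fintype ι] {s t : ι → Fin 2}
    (h : ∑ i, (s i : ℕ) * (t i : ℕ) = 0) (i : ι) : s i = 0 ∨ t i = 0 :=
  (mul_eq_zero.1 (Finset.sum_eq_zero_iff.1 h i (Finset.mem_univ i))).imp
    (fun h => Fin.ext h) fun h => Fin.ext h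

open Module.End HilbertTensor

/-- A spatial perfect strategy of an imitation game is a convex combination of trace correlations,
one for each eigenspace of the reduced density operator. -/
theorem Game.mem_convexHull_of_isRealizedBy {G : Game X Y A B} (hG : G.IsImitation)
    {p : Correlation X Y A B} (hpG : p ∈ G.perfectStrategies)
    {H : Type*} [NormedAddCommGroup H] [InnerProductSpace ℂ H] [CompleteSpace H]
    {ξ : HilbertTensor H H} (hξ : ‖ξ‖ = 1) (hp : IsRealizedBy p ξ) :
    p ∈ convexHull ℝ {p | IsTraceRealized p} := by
  obtain ⟨P, Q, hP, hQ, hPQ⟩ := hp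
  set S := slice ξ
  set T := sliceRight ξ
  have hST : ∀ u v, inner ℂ v (S u) = inner ℂ u (T v) := fun u v =>
    (inner_slice ξ u v).trans (inner_sliceRight ξ u v).symm
  have hzero : ∀ x y a b, G.rule x y a b = 0 → tensorOp (P x a) (Q y b) ξ = 0 :=
    fun x y a b hr => tensorOp_eq_zero ((hP x).1 a) ((hQ y).1 b) (by
      rw [← hPQ, hpG.2 x y a b hr, Complex.ofReal_zero])
  have hPTQ : ∀ x y a b, G.rule x y a b = 0 → ∀ v, P x a (T (Q y b v)) = 0 :=
    fun x y a b hr v => by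
      have h := sliceRight_tensorOp (P x a) (Q y b) ξ v
      rw [hzero x y a b hr, map_zero, ((hQ y).1 b).isSelfAdjoint.star_eq] at h
      exact h.symm
  have hQSP : ∀ x y a b, G.rule x y a b = 0 → ∀ u, Q y b (S (P x a u)) = 0 :=
    fun x y a b hr u => by
      have h := slice_tensorOp (P x a) (Q y b) ξ u
      rw [hzero x y a b hr, map_zero, ((hP x).1 a).isSelfAdjoint.star_eq] at h
      exact h.symm
  -- The imitation property makes the off-diagonal corners of `T S` and `S T` vanish.
  have hcP : ∀ x a, Commute (P x a) (T.comp S : H →L[ℂ] H) := fun x =>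
    (hP x).commute fun a a' haa' => by
      obtain ⟨y, hy⟩ := hG.left x a a' haa'
      exact mul_comp_mul_eq_zero (hQ y) fun b => (eq_zero_or_eq_zero_of_sum_mul_eq_zero hy b).imp
        (fun h => hPTQ x y a b h) fun h => hQSP x y a' b h
  have hcQ : ∀ y b, Commute (Q y b) (S.comp T : H →L[ℂ] H) := fun y =>
    (hQ y).commute fun b b' hbb' => by
      obtain ⟨x, hx⟩ := hG.right y b b' hbb'
      exact mul_comp_mul_eq_zero (hP x) fun a => (eq_zero_or_eq_zero_of_sum_mul_eq_zero hx a).imp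
        (fun h => hQSP x y a b h) fun h => hPTQ x y a b' h
  -- `R` is the reduced density operator of `ξ`.
  set R : H →L[ℂ] H := T.comp S
  have hR : IsSelfAdjoint R := isSelfAdjoint_comp hST
  have hRc : IsCompactOperator R := (isCompactOperator_slice ξ).clm_comp T
  have hfin : ∀ μ : NonzeroEigenvalue R,
      FiniteDimensional ℂ (eigenspace (R : Module.End ℂ H) μ.1) := fun μ =>
    ContinuousLinearMap.finite_dimensional_eigenspace hRc μ.1 μ.2.1
  let d := fun μ : NonzeroEigenvalue R => Module.finrank ℂ (eigenspace (R : Module.End ℂ H) μ.1)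
  let e := fun μ : NonzeroEigenvalue R =>
    stdOrthonormalBasis ℂ (eigenspace (R : Module.End ℂ H) μ.1)
  have hd : ∀ μ, 0 < d μ := fun μ => by
    have : Nontrivial (eigenspace (R : Module.End ℂ H) μ.1) :=
      Submodule.nontrivial_iff_ne_bot.2 μ.2.2
    exact Module.finrank_pos
  have hRe : ∀ (μ : NonzeroEigenvalue R) i, R (e μ i) = μ.1 • (e μ i : H) := fun μ i =>
    mem_eigenspace_iff.1 (e μ i).2
  have hSe : ∀ (μ : NonzeroEigenvalue R) i, inner ℂ (S (e μ i)) (S (e μ i)) = μ.1 := fun μ i => by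
    have h1 : inner ℂ (S (e μ i)) (S (e μ i)) = inner ℂ (e μ i : H) (R (e μ i)) := hST _ _
    rw [h1, hRe, inner_smul_right, ← Submodule.coe_inner, inner_self_eq_norm_sq_to_K,
      (e μ).norm_eq_one]
    simp
  have hμ : ∀ μ : NonzeroEigenvalue R, ∃ r : ℝ, 0 < r ∧ μ.1 = r := fun μ => by
    have h1 : ((‖S (e μ ⟨0, hd μ⟩)‖ ^ 2 : ℝ) : ℂ) = μ.1 := by
      refine Eq.trans ?_ (hSe μ ⟨0, hd μ⟩)
      rw [inner_self_eq_norm_sq_to_K, Complex.ofReal_pow]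
      rfl
    refine ⟨‖S (e μ ⟨0, hd μ⟩)‖ ^ 2, (sq_nonneg _).lt_of_ne' fun h2 => μ.2.1 ?_, h1.symm⟩
    exact h1.symm.trans ((congrArg Complex.ofReal h2).trans Complex.ofReal_zero)
  choose r hr0 hr using hμ
  let P' := fun (μ : NonzeroEigenvalue R) x a => (e μ).compress (P x a)
  let Q' := fun (μ : NonzeroEigenvalue R) y b => μ.1⁻¹ • (e μ).compress (T.comp ((Q y b).comp S))
  have hP' : ∀ μ x, IsPVM (P' μ x) := fun μ x => (hP x).compress (e μ) (hcP x)
  have hQ' : ∀ μ y, IsPVM (Q' μ y) := fun μ y =>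
    (hQ y).compress_comp_comp (e μ) hST (hcQ y) μ.2.1 (by rw [hr]; exact Complex.conj_ofReal _)
  -- The trace correlation of the PVMs induced on the eigenspace for `μ`.
  let z : NonzeroEigenvalue R → Correlation X Y A B := fun μ x y a b =>
    ((d μ : ℂ)⁻¹ * (P' μ x a * Q' μ y b).trace).re
  have hz : ∀ μ x y a b, (z μ x y a b : ℂ) = (d μ : ℂ)⁻¹ * (P' μ x a * Q' μ y b).trace :=
    fun μ x y a b => (Complex.eq_re_of_ofReal_le (r := 0) (by
      rw [Complex.ofReal_zero]
      exact ((hP' μ x).1 a).normalized_trace_mul_nonneg ((hQ' μ y).1 b) (d μ))).symm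
  have hsum : ∀ η, HasSum (fun μ => ∑ i, inner ℂ (S (e μ i)) (slice η (e μ i))) (inner ℂ ξ η) := by
    intro η
    have hu : Orthonormal ℂ fun k : (μ : NonzeroEigenvalue R) × Fin (d μ) => (e k.1 k.2 : H) :=
      ((hR.isSymmetric.orthogonalFamily_eigenspaces).comp
        (Subtype.val_injective (p := fun μ : ℂ => μ ≠ 0 ∧ _))).orthonormal_sigma_orthonormal
          fun μ => (e μ).orthonormal
    refine (hasSum_inner_slice hu (fun w hw => ?_) η).sigma fun μ => hasSum_fintype _
    have h1 : R w = 0 := hRc.apply_eq_zero_of_inner_eq_zero hR fun μ u hu => by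
      have h2 := congrArg (fun u : eigenspace (R : Module.End ℂ H) μ.1 => inner ℂ (u : H) w)
        ((e μ).sum_repr ⟨u, hu⟩)
      simp only [Submodule.coe_sum, Submodule.coe_smul, sum_inner, inner_smul_left] at h2
      rw [← h2]
      exact Finset.sum_eq_zero fun i _ => by rw [hw ⟨μ, i⟩, mul_zero]
    have h2 := inner_comp_self hST w
    change inner ℂ w (R w) = _ at h2
    rw [h1, inner_zero_right] at h2
    exact norm_eq_zero.1 (by exact_mod_cast pow_eq_zero_iff two_ne_zero |>.1 h2.symm)
  -- The weight of the eigenspace for `μ` is the trace `μ · dim` of `R` on it.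
  refine mem_convexHull_of_hasSum (c := fun μ => r μ * d μ) (z := z)
    (fun μ => mul_pos (hr0 μ) (Nat.cast_pos.2 (hd μ)))
    (fun μ => ⟨d μ, P' μ, Q' μ, hd μ, hP' μ, hQ' μ, hz μ⟩) ?_ ?_
  · have h1 := hsum ξ
    rw [inner_self_eq_norm_sq_to_K, hξ] at h1
    rw [← Complex.hasSum_ofReal]
    convert h1 using 2 with μ
    · push_cast
      rw [Finset.sum_congr rfl fun i _ => hSe μ i, Finset.sum_const, Finset.card_univ,
        Fintype.card_fin, nsmul_eq_mul, ← hr, mul_comm]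
    · simp
  · simp_rw [Pi.hasSum]
    intro x y a b
    rw [← Complex.hasSum_ofReal, hPQ]
    convert hsum (tensorOp (P x a) (Q y b) ξ) using 2 with μ
    have hK := star_comp_comp hST (Q y b)
    rw [((hQ y).1 b).isSelfAdjoint.star_eq] at hK
    have h1 : ∀ i, inner ℂ (S (e μ i)) (slice (tensorOp (P x a) (Q y b) ξ) (e μ i)) =
        (P' μ x a * (e μ).compress (T.comp ((Q y b).comp S))) i i := fun i => by
      rw [slice_tensorOp, inner_comp_comp hST, ← (e μ).compress_mul _
        (mapsTo_eigenspace (commute_comp_comp (hcQ y b)) μ.1), OrthonormalBasis.compress_apply,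
        ← hK, ((hP x).1 a).isSelfAdjoint.star_eq, mul_apply_eq_comp,
        ← ContinuousLinearMap.adjoint_inner_left, ← ContinuousLinearMap.star_eq_adjoint,
        ((hP x).1 a).isSelfAdjoint.star_eq, ContinuousLinearMap.star_eq_adjoint,
        ContinuousLinearMap.adjoint_inner_right]
      rfl
    have h2 : (P' μ x a * (e μ).compress (T.comp ((Q y b).comp S))).trace =
        μ.1 * (P' μ x a * Q' μ y b).trace := by
      simp only [Q']
      rw [mul_smul_comm, Matrix.trace_smul, smul_eq_mul, mul_inv_cancel_left₀ μ.2.1]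
    rw [Finset.sum_congr rfl fun i _ => h1 i]
    change _ = Matrix.trace _
    have h3 : (d μ : ℂ) ≠ 0 := Nat.cast_ne_zero.2 (hd μ).ne'
    rw [h2, Pi.smul_apply, Pi.smul_apply, Pi.smul_apply, Pi.smul_apply, smul_eq_mul,
      Complex.ofReal_mul, hz, Complex.ofReal_mul, ← hr, Complex.ofReal_natCast, mul_assoc,
      mul_inv_cancel_left₀ h3]

end

/-! ### The equivalence -/

section

variable {X Y A B : Type*} [Fintype A] [Fintype B]

theorem maxEntangledCorrelations_eq :
    maxEntangledCorrelations.{u} X Y A B = {p | IsTraceRealized p} :=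
  Set.ext fun _ => mem_maxEntangledCorrelations_iff

theorem Game.quantumMaxEntangled_inter (G : Game X Y A B) :
    quantumMaxEntangled.{u} X Y A B ∩ G.perfectStrategies =
      convexHull ℝ (maxEntangledCorrelations.{u} X Y A B ∩ G.perfectStrategies) :=
  G.convexHull_inter_perfectStrategies fun _ hp =>
    (mem_maxEntangledCorrelations_iff.1 hp).isNonSignalling

/-- A unital homomorphism to an algebra with a tracial state has a nonzero domain. -/
theorem IsTracialState.nontrivial {D F : Type*} [CStarAlgebra D] [CStarAlgebra F] {τ : F →ₗ[ℂ] ℂ}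
    (hτ : IsTracialState τ) (π : D →⋆ₐ[ℂ] F) : Nontrivial D := by
  refine nontrivial_of_ne 1 0 fun h => one_ne_zero (α := ℂ) ?_
  rw [← hτ.map_one, ← _root_.map_one π, h, map_zero, map_zero]

theorem Game.tfae_of_isImitation [Fintype X] [Fintype Y] {G : Game X Y A B} (hG : G.IsImitation)
    {p : Correlation X Y A B} (hp : IsNonSignalling p) :
    List.TFAE [
      p ∈ quantumSpatial.{u} X Y A B ∩ G.perfectStrategies,
      p ∈ quantum.{u} X Y A B ∩ G.perfectStrategies,
      p ∈ quantumMaxEntangled.{u} X Y A B ∩ G.perfectStrategies,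
      Nontrivial G.CStar ∧
        ∃ (F : Type v) (_ : CStarAlgebra F) (_ : FiniteDimensional ℂ F) (τ : F →ₗ[ℂ] ℂ)
          (π : G.CStar →⋆ₐ[ℂ] F), IsTracialState τ ∧
            ∀ x y a b, (p x y a b : ℂ) = τ (π (G.projA x a * G.projB y b))] := by
  tfae_have 1 → 3 := by
    rintro ⟨⟨H, _, _, _, ξ, hξ, h⟩, hpG⟩
    refine ⟨?_, hpG⟩
    rw [quantumMaxEntangled, maxEntangledCorrelations_eq]
    exact Game.mem_convexHull_of_isRealizedBy hG hpG hξ h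
  tfae_have 3 → 4 := by
    intro h
    rw [G.quantumMaxEntangled_inter, maxEntangledCorrelations_eq] at h
    obtain ⟨F, _, _, τ, π, hτ, h⟩ := G.exists_tracialState h
    exact ⟨hτ.nontrivial π, F, inferInstance, inferInstance, τ, π, hτ, h⟩
  tfae_have 4 → 2 := by
    rintro ⟨-, F, _, _, τ, π, hτ, h⟩
    refine ⟨G.mem_quantum_of_tracialState hτ h, hp, fun x y a b hr => ?_⟩
    have h0 := h x y a b
    rw [G.projA_mul_projB_eq_zero hr, map_zero, map_zero] at h0
    exact_mod_cast h0
  tfae_have 2 → 1 := by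
    rintro ⟨⟨H, i1, i2, i3, -, ξ, h⟩, hpG⟩
    exact ⟨⟨H, i1, i2, i3, ξ, h⟩, hpG⟩
  tfae_finish

end

/-- In the synchronicity game, the question `x` itself tells apart two answers to `x`. -/
theorem isImitation_syncGame (X A : Type*) [Fintype A] : (syncGame X A).IsImitation := by
  constructor
  · refine fun x a a' h => ⟨x, Finset.sum_eq_zero fun b _ => ?_⟩
    by_cases hb : a = b
    · subst hb
      simp [syncGame, Ne.symm h]
    · simp [syncGame, hb]
  · refine fun x a a' h => ⟨x, Finset.sum_eq_zero fun b _ => ?_⟩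
    by_cases hb : b = a
    · subst hb
      simp [syncGame, h]
    · simp [syncGame, hb]

theorem mainTheorem2 {X Y A B : Type*} [Fintype X] [Fintype Y] [Fintype A] [Fintype B] :
    (∀ (G : Game X Y A B) (p : Correlation X Y A B), G.IsImitation → IsNonSignalling p →
      List.TFAE [
        p ∈ quantumSpatial.{u} X Y A B ∩ G.perfectStrategies,
        p ∈ quantum.{u} X Y A B ∩ G.perfectStrategies,
        p ∈ quantumMaxEntangled.{u} X Y A B ∩ G.perfectStrategies,
        Nontrivial G.CStar ∧
          ∃ (F : Type v) (_ : CStarAlgebra F) (_ : FiniteDimensional ℂ F) (τ : F →ₗ[ℂ] ℂ)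
            (π : G.CStar →⋆ₐ[ℂ] F), IsTracialState τ ∧
              ∀ x y a b, (p x y a b : ℂ) = τ (π (G.projA x a * G.projB y b))]) ∧
    quantum.{u} X X A A ∩ (syncGame X A).perfectStrategies =
      quantumSpatial.{u} X X A A ∩ (syncGame X A).perfectStrategies ∧
    quantum.{u} X X A A ∩ (syncGame X A).perfectStrategies =
      quantumMaxEntangled.{u} X X A A ∩ (syncGame X A).perfectStrategies ∧
    quantumMaxEntangled.{u} X X A A ∩ (syncGame X A).perfectStrategies =
      convexHull ℝ (maxEntangledCorrelations.{u} X X A A ∩ (syncGame X A).perfectStrategies) := by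
  refine ⟨fun G p hG hp => Game.tfae_of_isImitation hG hp, ?_, ?_,
    (syncGame X A).quantumMaxEntangled_inter⟩
  · ext p
    by_cases hp : IsNonSignalling p
    · exact (Game.tfae_of_isImitation.{u, 0} (isImitation_syncGame X A) hp).out 1 0
    · exact ⟨fun h => (hp h.2.1).elim, fun h => (hp h.2.1).elim⟩
  · ext p
    by_cases hp : IsNonSignalling p
    · exact (Game.tfae_of_isImitation.{u, 0} (isImitation_syncGame X A) hp).out 1 2
    · exact ⟨fun h => (hp h.2.1).elim, fun h => (hp h.2.1).elim⟩
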